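/- Let $n,k\ge 0$ be integers, and write $B(x,r)$ for the open ball of radius $r$ about $x$ in $\mathbb{R}^n$ and $d_H$ for the Hausdorff distance. A compact connected nonempty set $X\subseteq\mathbb{R}^n$ is called $k$-dimensional $(\varepsilon,R)$ Reifenberg flat (where $\varepsilon,R>0$) if for every $x\in X$ and every $0<r<R$ there is a $k$-dimensional affine plane $P_{x,r}$ through $x$ such that $d_H(B(x,r)\cap P_{x,r},\,B(x,r)\cap X)\le\varepsilon r$. **Theorem 2.1.** For every $\delta>0$ there exists $\varepsilon>0$ (depending only on $\delta$, $n$ and $k$) such that for every $R>0$ and every $k$-dimensional $(\varepsilon,R)$ Reifenberg flat set $X\subseteq\mathbb{R}^n$ the following holds. For every $0<r<R/10$ there exists a compact smooth ($C^\infty$) embedded $k$-dimensional submanifold $X^r\subseteq\mathbb{R}^n$ without boundary such that 1. $d_H(X,X^r)\le\delta r$; 2. $|A^r|\le\delta/r$ everywhere on $X^r$, where $A^r$ is the second fundamental form of $X^r$ and $|A^r|$ is its norm, $|A^r|^2=\sum_{i,j}|A^r(e_i,e_j)|^2$ for an orthonormal basis $(e_i)$ of the tangent space; 3. for every $x\in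 X$ one can write $X^r\cap B(x,r)=G\cup B$, where $G$ is connected (and nonempty) and $B\subseteq B(x,r)\setminus B(x,(1-\delta)r)$. -/

import Mathlib

open scoped ContDiff

/-- A compact connected (hence nonempty) set `X ⊆ ℝⁿ` is `k`-dimensional `(ε, R)` Reifenberg flat
if for all `x ∈ X` and `0 < r < R` there is a `k`-dimensional affine plane `P` through `x` with
`d_H (B(x,r) ∩ P, B(x,r) ∩ X) ≤ ε r`. The Hausdorff distance is taken with values in `[0, ∞]`. -/
structure IsReifenbergFlat {n : ℕ} (k : ℕ) (ε R : ℝ) (X : Set (EuclideanSpace ℝ (Fin n))) :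
    Prop where
  isCompact : IsCompact X
  isConnected : IsConnected X
  exists_plane : ∀ x ∈ X, ∀ r : ℝ, 0 < r → r < R →
    ∃ P : AffineSubspace ℝ (EuclideanSpace ℝ (Fin n)),
      x ∈ P ∧ Module.finrank ℝ P.direction = k ∧
      Metric.hausdorffEDist (Metric.ball x r ∩ (P : Set (EuclideanSpace ℝ (Fin n))))
        (Metric.ball x r ∩ X) ≤ ENNReal.ofReal (ε * r)

/-- A smooth local parametrization of `M ⊆ ℝⁿ` by an open set `source` of `ℝᵏ`: a smooth
immersion `toFun` that maps `source` homeomorphically onto the relatively open subset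
`M ∩ nhd` of `M`; `inv` is the continuous inverse. -/
structure LocalParam {n : ℕ} (k : ℕ) (M : Set (EuclideanSpace ℝ (Fin n))) where
  toFun : EuclideanSpace ℝ (Fin k) → EuclideanSpace ℝ (Fin n)
  inv : EuclideanSpace ℝ (Fin n) → EuclideanSpace ℝ (Fin k)
  source : Set (EuclideanSpace ℝ (Fin k))
  nhd : Set (EuclideanSpace ℝ (Fin n))
  isOpen_source : IsOpen source
  isOpen_nhd : IsOpen nhd
  contDiffOn : ContDiffOn ℝ ∞ toFun source
  injective_fderiv : ∀ u ∈ source, Function.Injective (fderiv ℝ toFun u)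
  image_source : toFun '' source = M ∩ nhd
  left_inv : ∀ u ∈ source, inv (toFun u) = u
  continuousOn_inv : ContinuousOn inv (M ∩ nhd)

/-- `M ⊆ ℝⁿ` is a smooth embedded `k`-dimensional submanifold (without boundary): every point of
`M` lies in the image of a smooth local parametrization. -/
def IsSmoothSubmanifold {n : ℕ} (k : ℕ) (M : Set (EuclideanSpace ℝ (Fin n))) : Prop :=
  ∀ p ∈ M, ∃ φ : LocalParam k M, p ∈ φ.nhd

namespace LocalParam

variable {n k : ℕ} {M : Set (EuclideanSpace ℝ (Fin n))}

/-- The tangent space of `M` at `φ u`, the range of `Dφ(u)`. -/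
noncomputable def tangent (φ : LocalParam k M) (u : EuclideanSpace ℝ (Fin k)) :
    Submodule ℝ (EuclideanSpace ℝ (Fin n)) :=
  LinearMap.range (fderiv ℝ φ.toFun u).toLinearMap

/-- The first fundamental form `g_{ij} = ⟨∂ᵢφ, ∂ⱼφ⟩`. -/
noncomputable def metric (φ : LocalParam k M) (u : EuclideanSpace ℝ (Fin k)) :
    Matrix (Fin k) (Fin k) ℝ :=
  Matrix.of fun i j =>
    inner ℝ (fderiv ℝ φ.toFun u (EuclideanSpace.single i 1))
      (fderiv ℝ φ.toFun u (EuclideanSpace.single j 1))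

/-- The coefficients `A(∂ᵢφ, ∂ⱼφ) = (∂ᵢ∂ⱼφ)^⊥` of the second fundamental form, where `^⊥` is the
orthogonal projection to the normal space. -/
noncomputable def secondForm (φ : LocalParam k M) (u : EuclideanSpace ℝ (Fin k))
    (i j : Fin k) : EuclideanSpace ℝ (Fin n) :=
  (φ.tangent u)ᗮ.starProjection
    (fderiv ℝ (fderiv ℝ φ.toFun) u (EuclideanSpace.single i 1) (EuclideanSpace.single j 1))

/-- The norm `|A|` of the second fundamental form at `φ u`:
`|A|² = ∑ g^{ac} g^{bd} ⟨A(∂ₐφ, ∂_bφ), A(∂_cφ, ∂_dφ)⟩`, with `(g^{ij})` the inverse of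
`(g_{ij})`. -/
noncomputable def normSecondForm (φ : LocalParam k M) (u : EuclideanSpace ℝ (Fin k)) : ℝ :=
  Real.sqrt (∑ a, ∑ b, ∑ c, ∑ d, (φ.metric u)⁻¹ a c * (φ.metric u)⁻¹ b d *
    inner ℝ (φ.secondForm u a b) (φ.secondForm u c d))

end LocalParam

/-- `|A| ≤ C` on all of `M`. The value of `|A|` at a point of `M` does not depend on the
parametrization in which it is computed. -/
def SecondFundFormLe {n : ℕ} (k : ℕ) (M : Set (EuclideanSpace ℝ (Fin n))) (C : ℝ) : Prop :=
  ∀ φ : LocalParam k M, ∀ u ∈ φ.source, φ.normSecondForm u ≤ C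

/-!
The approximating manifold is the zero set of a section of an approximate normal bundle, built from
the planes of `X` at the single scale `9 r`.

After rescaling, `r = 1`. Average the normal projections `P p` of the planes at the points `p` of a
separated net of `X` with a smooth partition of unity; this gives `T y`, which is close to a
projection. Average likewise the normal displacements `P p (y - p)`; this gives `v y`. The kernel
of the spectral projection of `T y` to the upper half of its spectrum is the approximate tangent
space at `y`, and `M` is the set of `y` for which `v y` lies in it. Instead of the spectral
projection it is enough to use `q (T y) = (√((2T - 1)²) + 2T - 1) / 2`, which has the same kernel;
the square root near `1` is smooth by the inverse function theorem for `C ↦ C²`, and commutes with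
`T` (`commute_of_commute_mul_self`, `exists_spectral_map`).

The bounds that make this work are uniform because at most `5ⁿ` net points matter at each point
(`c2Bound_sum_netBump`) and because planes at nearby points of `X` make an angle `O(ε)`
(`PlaneField.norm_starProjection_sub_le`). They show that around `x ∈ X`, with `V` the direction of
the plane at `x`, the set `M` is `{y | y + ζ y - x ∈ V}` where `ζ` is as small as desired in `C²`
(`exists_localDesc_level_set`). All conclusions follow from this description (`LocalDesc`):

* `y ↦ y + ζ y` is a diffeomorphism close to the identity that straightens `M`, which gives local
  parametrizations, the Hausdorff distance, and the connected piece as the preimage of a disc;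
* differentiating `φ + ζ ∘ φ - x ∈ V` twice along any local parametrization `φ` bounds the second
  fundamental form by `D²ζ`.
-/

/-! ### Uniform bounds up to order two -/

section C2

variable {E F G H : Type*} [NormedAddCommGroup E] [NormedSpace ℝ E]
  [NormedAddCommGroup F] [NormedSpace ℝ F] [NormedAddCommGroup G] [NormedSpace ℝ G]
  [NormedAddCommGroup H] [NormedSpace ℝ H]

/-- `f` is smooth on `U`, and `f`, `Df`, `D²f` are bounded by `a` there. For open `U` the
derivatives within `U` are the usual ones. -/
structure C2Bound (a : ℝ) (U : Set E) (f : E → F) : Prop where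
  contDiffOn : ContDiffOn ℝ ∞ f U
  bound : ∀ i ≤ 2, ∀ y ∈ U, ‖iteratedFDerivWithin ℝ i f U y‖ ≤ a

namespace C2Bound

variable {a b : ℝ} {U : Set E} {f g : E → F}

theorem mono (hf : C2Bound a U f) (hab : a ≤ b) : C2Bound b U f :=
  ⟨hf.1, fun i hi y hy => (hf.2 i hi y hy).trans hab⟩

theorem norm_le (hf : C2Bound a U f) {y : E} (hy : y ∈ U) : ‖f y‖ ≤ a := by
  simpa using hf.2 0 (by norm_num) y hy

theorem congr (hf : C2Bound a U f) (h : ∀ y ∈ U, g y = f y) : C2Bound a U g :=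
  ⟨hf.1.congr h, fun i hi y hy => by
    rw [iteratedFDerivWithin_congr (fun z hz => h z hz) hy]; exact hf.2 i hi y hy⟩

theorem add (hU : IsOpen U) (hf : C2Bound a U f) (hg : C2Bound b U g) :
    C2Bound (a + b) U (fun y => f y + g y) := by
  refine ⟨hf.1.add hg.1, fun i hi y hy => ?_⟩
  have := fun_iteratedFDerivWithin_add_apply (i := i)
    ((hf.1 y hy).of_le (by exact_mod_cast le_top)) ((hg.1 y hy).of_le (by exact_mod_cast le_top))
    hU.uniqueDiffOn hy
  rw [this]
  exact (norm_add_le _ _).trans (add_le_add (hf.2 i hi y hy) (hg.2 i hi y hy))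

theorem const (U : Set E) (c : F) : C2Bound ‖c‖ U (fun _ => c) := by
  refine ⟨contDiffOn_const, fun i hi y hy => ?_⟩
  rcases Nat.eq_zero_or_pos i with rfl | h
  · simp
  · rw [iteratedFDerivWithin_const_of_ne h.ne']
    simp

theorem bilin (hU : IsOpen U) (B : F →L[ℝ] G →L[ℝ] H) (hB : ‖B‖ ≤ 1) {g : E → G}
    (ha : 0 ≤ a) (hf : C2Bound a U f) (hg : C2Bound b U g) :
    C2Bound (4 * a * b) U (fun y => B (f y) (g y)) := by
  refine ⟨B.isBoundedBilinearMap.contDiff.comp_contDiffOn (hf.1.prodMk hg.1), fun i hi y hy => ?_⟩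
  have hb : 0 ≤ b := (norm_nonneg _).trans (hg.norm_le hy)
  have h := B.norm_iteratedFDerivWithin_le_of_bilinear_of_le_one hf.1 hg.1 hU.uniqueDiffOn hy
    (n := i) (by exact_mod_cast le_top) hB
  refine h.trans ?_
  calc _ ≤ ∑ j ∈ Finset.range (i + 1), (i.choose j : ℝ) * a * b := by
        refine Finset.sum_le_sum fun j hj => ?_
        have h1 := hf.2 j (by have := Finset.mem_range.1 hj; omega) y hy
        have h2 := hg.2 (i - j) (by omega) y hy
        gcongr
    _ = 2 ^ i * a * b := by
        rw [← Finset.sum_mul, ← Finset.sum_mul]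
        norm_cast
        rw [Nat.sum_range_choose]
    _ ≤ 4 * a * b := by
        have : (2 : ℝ) ^ i ≤ 4 := by interval_cases i <;> norm_num
        gcongr

theorem clm_apply (hU : IsOpen U) {f : E → F →L[ℝ] G} {g : E → F} (ha : 0 ≤ a)
    (hf : C2Bound a U f) (hg : C2Bound b U g) : C2Bound (4 * a * b) U (fun y => f y (g y)) :=
  bilin hU (ContinuousLinearMap.id ℝ (F →L[ℝ] G)) ContinuousLinearMap.norm_id_le ha hf hg

theorem smul (hU : IsOpen U) {f : E → ℝ} {g : E → F} (ha : 0 ≤ a)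
    (hf : C2Bound a U f) (hg : C2Bound b U g) : C2Bound (4 * a * b) U (fun y => f y • g y) :=
  bilin hU (ContinuousLinearMap.lsmul ℝ ℝ) ContinuousLinearMap.opNorm_lsmul_le ha hf hg

theorem mul {A : Type*} [NormedRing A] [NormedAlgebra ℝ A] (hU : IsOpen U) {f g : E → A}
    (ha : 0 ≤ a) (hf : C2Bound a U f) (hg : C2Bound b U g) :
    C2Bound (4 * a * b) U (fun y => f y * g y) :=
  bilin hU (ContinuousLinearMap.mul ℝ A) (ContinuousLinearMap.opNorm_mul_le _ _) ha hf hg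

theorem clm_comp_left (hU : IsOpen U) (L : F →L[ℝ] G) (hL : ‖L‖ ≤ 1)
    (hf : C2Bound a U f) : C2Bound a U (fun y => L (f y)) := by
  refine ⟨L.contDiff.comp_contDiffOn hf.1, fun i hi y hy => ?_⟩
  have := L.norm_iteratedFDerivWithin_comp_left (hf.1 y hy) hU.uniqueDiffOn hy
    (n := i) (by exact_mod_cast le_top)
  refine this.trans ?_
  exact (mul_le_mul hL (hf.2 i hi y hy) (norm_nonneg _) zero_le_one).trans_eq (one_mul a)

theorem sub_const (hU : IsOpen U) (x : E) {ρ : ℝ} (hρ : 1 ≤ ρ) (h : U ⊆ Metric.ball x ρ) :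
    C2Bound ρ U (fun y => y - x) := by
  refine ⟨contDiffOn_id.sub contDiffOn_const, fun i hi y hy => ?_⟩
  have h1 : ∀ z ∈ U, fderivWithin ℝ (fun y => y - x) U z = ContinuousLinearMap.id ℝ E := by
    intro z hz
    rw [fderivWithin_of_isOpen hU hz]
    exact ((hasFDerivAt_id z).sub_const x).fderiv
  interval_cases i
  · simpa [dist_eq_norm] using (Metric.mem_ball.1 (h hy)).le
  · rw [norm_iteratedFDerivWithin_one _ (hU.uniqueDiffOn y hy), h1 y hy]
    exact ContinuousLinearMap.norm_id_le.trans hρ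
  · rw [← norm_iteratedFDerivWithin_fderivWithin hU.uniqueDiffOn hy,
      iteratedFDerivWithin_congr (fun z hz => h1 z hz) hy,
      iteratedFDerivWithin_const_of_ne one_ne_zero]
    simp only [Pi.zero_apply, norm_zero]
    linarith

theorem norm_fderiv_le (hU : IsOpen U) (hf : C2Bound a U f) {y : E} (hy : y ∈ U) :
    ‖fderiv ℝ f y‖ ≤ a := by
  have := hf.2 1 (by norm_num) y hy
  rwa [norm_iteratedFDerivWithin_one _ (hU.uniqueDiffOn y hy), fderivWithin_of_isOpen hU hy] at this

theorem norm_fderiv_fderiv_le (hU : IsOpen U) (hf : C2Bound a U f) {y : E} (hy : y ∈ U) :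
    ‖fderiv ℝ (fderiv ℝ f) y‖ ≤ a := by
  have := hf.2 2 le_rfl y hy
  rw [← norm_iteratedFDerivWithin_fderivWithin hU.uniqueDiffOn hy,
    norm_iteratedFDerivWithin_one _ (hU.uniqueDiffOn y hy), fderivWithin_of_isOpen hU hy] at this
  have h2 : fderiv ℝ (fderivWithin ℝ f U) y = fderiv ℝ (fderiv ℝ f) y := by
    apply Filter.EventuallyEq.fderiv_eq
    filter_upwards [hU.mem_nhds hy] with z hz using fderivWithin_of_isOpen hU hz
  rwa [h2] at this

/-- The derivatives of order at least one of `g ∘ f` are small if those of `f` are. The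
estimate for compositions asks for the `i`-th derivative of `f` to be at most `D ^ i`, so a uniform
bound `a ≤ 1` on the derivatives of `f` only allows `D = √a`. -/
theorem norm_iteratedFDerivWithin_comp_le' (hU : IsOpen U) {W : Set F} (hW : IsOpen W)
    {g : F → G} {C D : ℝ} (hC : 0 ≤ C) (hD : 0 ≤ D) (hg : ContDiffOn ℝ ∞ g W)
    (hgC : ∀ i ≤ 2, ∀ z ∈ W, ‖iteratedFDerivWithin ℝ i g W z‖ ≤ C)
    (hf : C2Bound a U f) (hfW : Set.MapsTo f U W) (haD : a ≤ D) (haD2 : a ≤ D ^ 2)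
    {i : ℕ} (hi : i ≤ 2) {y : E} (hy : y ∈ U) :
    ‖iteratedFDerivWithin ℝ i (g ∘ f) U y‖ ≤ 2 * C * D ^ i := by
  have h := norm_iteratedFDerivWithin_comp_le (n := i) hg hf.1 (by exact_mod_cast le_top)
    hW.uniqueDiffOn hU.uniqueDiffOn hfW hy (C := C) (D := D)
    (fun j hj => hgC j (hj.trans hi) _ (hfW hy))
    (fun j hj hji => by
      have h2 : j ≤ 2 := hji.trans hi
      refine (hf.2 j h2 y hy).trans ?_
      interval_cases j
      · simpa using haD
      · exact haD2)
  refine h.trans ?_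
  have : (Nat.factorial i : ℝ) ≤ 2 := by interval_cases i <;> norm_num [Nat.factorial]
  gcongr

/-- A smooth function that vanishes at `0` turns `C²`-small functions into `C²`-small ones. The
outer function is analytic at `0`, so that it is smooth on a whole neighbourhood. -/
theorem exists_comp {g : F → G} [CompleteSpace G] (hg : ContDiffAt ℝ ω g 0) (hg0 : g 0 = 0)
    {η : ℝ} (hη : 0 < η) :
    ∃ a > 0, ∀ (U : Set E), IsOpen U → ∀ f : E → F, C2Bound a U f → C2Bound η U (g ∘ f) := by
  have h1 : ∀ᶠ z in nhds (0 : F), ContDiffAt ℝ ω g z := hg.eventually (by simp)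
  have h2 : ∀ᶠ z in nhds (0 : F), ‖g z‖ ≤ η := by
    have : Filter.Tendsto (fun z => ‖g z‖) (nhds 0) (nhds 0) := by
      have h := hg.continuousAt.norm.tendsto
      rwa [hg0, norm_zero] at h
    exact this.eventually (ge_mem_nhds hη)
  have h3 : ∀ i : ℕ, ∀ᶠ z in nhds (0 : F),
      ‖iteratedFDeriv ℝ i g z‖ ≤ ‖iteratedFDeriv ℝ i g 0‖ + 1 := by
    intro i
    have hc : ContinuousAt (iteratedFDeriv ℝ i g) 0 :=
      (hg.iteratedFDeriv_right (m := 0) (i := i) (by simp)).continuousAt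
    exact hc.norm.eventually (ge_mem_nhds (by linarith))
  obtain ⟨τ, hτ, hW⟩ := Metric.eventually_nhds_iff_ball.1
    (h1.and (h2.and ((h3 0).and ((h3 1).and (h3 2)))))
  set C := ‖iteratedFDeriv ℝ 0 g 0‖ + ‖iteratedFDeriv ℝ 1 g 0‖ + ‖iteratedFDeriv ℝ 2 g 0‖ + 1
  have hC : 0 < C := by positivity
  set D := min 1 (η / (2 * C))
  have hD : 0 < D := by positivity
  have hD1 : D ≤ 1 := min_le_left _ _
  have hDη : 2 * C * D ≤ η := by
    have : D ≤ η / (2 * C) := min_le_right _ _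
    rwa [le_div_iff₀ (by positivity), mul_comm] at this
  have hWo : IsOpen (Metric.ball (0 : F) τ) := Metric.isOpen_ball
  refine ⟨min (D ^ 2) (τ / 2), by positivity, fun U hU f hf => ?_⟩
  have hmaps : Set.MapsTo f U (Metric.ball 0 τ) := by
    intro y hy
    rw [mem_ball_zero_iff]
    exact (hf.norm_le hy).trans_lt ((min_le_right _ _).trans_lt (by linarith))
  have hgW : ContDiffOn ℝ ∞ g (Metric.ball 0 τ) := fun z hz =>
    ((hW z hz).1.of_le (by simp)).contDiffWithinAt
  refine ⟨hgW.comp hf.1 hmaps, fun i hi y hy => ?_⟩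
  rcases Nat.eq_zero_or_pos i with rfl | hpos
  · simpa using (hW _ (hmaps hy)).2.1
  have key := norm_iteratedFDerivWithin_comp_le' hU hWo hC.le hD.le hgW (fun j hj z hz => ?_) hf
    hmaps ((min_le_left _ _).trans (by nlinarith)) (min_le_left _ _) hi hy
  · refine key.trans (le_trans ?_ hDη)
    have : D ^ i ≤ D ^ 1 := pow_le_pow_of_le_one hD.le hD1 hpos
    rw [pow_one] at this
    gcongr
  · rw [iteratedFDerivWithin_of_isOpen j hWo hz]
    obtain ⟨-, -, h0, h1, h2⟩ := hW z hz
    have n0 := norm_nonneg (iteratedFDeriv ℝ 0 g 0)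
    have n1 := norm_nonneg (iteratedFDeriv ℝ 1 g 0)
    have n2 := norm_nonneg (iteratedFDeriv ℝ 2 g 0)
    interval_cases j <;> linarith

/-- On `[1, N]` the derivatives of `t ↦ t⁻¹` are bounded by compactness. -/
theorem exists_inv (N : ℝ) : ∃ C > 0, ∀ (U : Set E), IsOpen U → ∀ f : E → ℝ, C2Bound N U f →
    (∀ y ∈ U, 1 ≤ f y) → C2Bound C U (fun y => (f y)⁻¹) := by
  have hgW : ContDiffOn ℝ ∞ (fun t : ℝ => t⁻¹) (Set.Ioi (0 : ℝ)) :=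
    contDiffOn_inv ℝ |>.mono fun t ht => (ne_of_gt ht : t ≠ 0)
  have hcont : ∀ i : ℕ, ContinuousOn (iteratedFDerivWithin ℝ i (fun t : ℝ => t⁻¹) (Set.Ioi 0))
      (Set.Icc 1 N) := fun i =>
    (hgW.continuousOn_iteratedFDerivWithin (m := i) (by exact_mod_cast le_top)
      isOpen_Ioi.uniqueDiffOn).mono fun t ht => lt_of_lt_of_le one_pos ht.1
  have hb : ∀ i : ℕ, ∃ c, ∀ t ∈ Set.Icc (1 : ℝ) N,
      ‖iteratedFDerivWithin ℝ i (fun t : ℝ => t⁻¹) (Set.Ioi 0) t‖ ≤ c := fun i =>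
    isCompact_Icc.exists_bound_of_continuousOn (hcont i)
  choose c hc using hb
  set C := max (c 0) 0 + max (c 1) 0 + max (c 2) 0
  set D := max 1 N
  have hC : 0 ≤ C := by positivity
  have hD1 : 1 ≤ D := le_max_left _ _
  refine ⟨2 * C * D ^ 2 + 1, by positivity, fun U hU f hf h1 => ?_⟩
  have hmaps : Set.MapsTo f U (Set.Ioi 0) := fun y hy => lt_of_lt_of_le one_pos (h1 y hy)
  refine ⟨hgW.comp hf.1 hmaps, fun i hi y hy => ?_⟩
  have hfN : f y ∈ Set.Icc 1 N := ⟨h1 y hy, (le_abs_self _).trans (hf.norm_le hy)⟩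
  have h := norm_iteratedFDerivWithin_comp_le (n := i) hgW hf.1 (by exact_mod_cast le_top)
    isOpen_Ioi.uniqueDiffOn hU.uniqueDiffOn hmaps hy (C := C) (D := D)
    (fun j hj => by
      have h2 := hc j _ hfN
      have n0 := le_max_left (c 0) 0
      have n1 := le_max_left (c 1) 0
      have n2 := le_max_left (c 2) 0
      have p0 := le_max_right (c 0) 0
      have p1 := le_max_right (c 1) 0
      have p2 := le_max_right (c 2) 0
      have : j ≤ 2 := hj.trans hi
      interval_cases j <;> linarith)
    (fun j hj hji => by
      refine (hf.2 j (hji.trans hi) y hy).trans ((le_max_right 1 N).trans ?_)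
      exact le_self_pow₀ hD1 (by omega))
  refine h.trans ?_
  have h2 : (Nat.factorial i : ℝ) ≤ 2 := by interval_cases i <;> norm_num [Nat.factorial]
  have h3 : D ^ i ≤ D ^ 2 := pow_le_pow_right₀ hD1 hi
  have : (Nat.factorial i : ℝ) * C * D ^ i ≤ 2 * C * D ^ 2 := by gcongr
  linarith

end C2Bound

end C2

/-! ### A smooth local square root -/

section SquareRoot

variable {A : Type*} [NormedRing A] [NormedAlgebra ℝ A]

/-- Inverse function theorem for `T ↦ T²` at `1`. -/
theorem exists_contDiffAt_sqrt [CompleteSpace A] : ∃ s : A → A, s 1 = 1 ∧ ContDiffAt ℝ ω s 1 ∧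
    ∀ᶠ T in nhds (1 : A), s T * s T = T := by
  have hc : ContDiffAt ℝ ω (fun T : A => T * T) 1 := (contDiff_id.mul contDiff_id).contDiffAt
  let L : A ≃L[ℝ] A := ContinuousLinearEquiv.smulLeft (Units.mk0 (2 : ℝ) two_ne_zero)
  have hd : HasFDerivAt (fun T : A => T * T) (L : A →L[ℝ] A) 1 := by
    refine ((hasFDerivAt_id (𝕜 := ℝ) (1 : A)).mul' (hasFDerivAt_id (𝕜 := ℝ) (1 : A))).congr_fderiv ?_
    ext v
    simp [L, two_smul, Units.smul_def]
  have hω : (ω : ℕ∞ω) ≠ 0 := by simp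
  refine ⟨hc.localInverse hd hω, ?_, ?_, ?_⟩
  · simpa using hc.localInverse_apply_image hd hω
  · simpa using hc.to_localInverse hd hω
  · have := (hc.hasStrictFDerivAt' hd hω).eventually_right_inverse
    rwa [mul_one] at this

/-- If `C` is close to `1`, whatever commutes with `C²` commutes with `C`: for
`K = BC - CB` one has `KC + CK = 0`, hence `2K = -(K(C-1) + (C-1)K)`. -/
theorem commute_of_commute_mul_self {B C : A} (hC : ‖C - 1‖ < 1) (h : B * (C * C) = C * C * B) :
    B * C = C * B := by
  set K := B * C - C * B with hK
  have h1 : K * C + C * K = 0 := by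
    have : K * C + C * K = B * (C * C) - C * C * B := by rw [hK]; noncomm_ring
    rw [this, h, sub_self]
  have h2 : (2 : ℝ) • K = -(K * (C - 1) + (C - 1) * K) := by
    have : K * (C - 1) + (C - 1) * K = (K * C + C * K) - (2 : ℝ) • K := by
      rw [two_smul]; noncomm_ring
    rw [this, h1]; simp
  have h3 : 2 * ‖K‖ ≤ 2 * ‖C - 1‖ * ‖K‖ := by
    calc 2 * ‖K‖ = ‖(2 : ℝ) • K‖ := by rw [norm_smul]; norm_num
      _ ≤ ‖K‖ * ‖C - 1‖ + ‖C - 1‖ * ‖K‖ := by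
        rw [h2, norm_neg]
        exact (norm_add_le _ _).trans (add_le_add (norm_mul_le _ _) (norm_mul_le _ _))
      _ = _ := by ring
  have h4 : ‖K‖ = 0 := by
    by_contra hne
    have hpos : 0 < ‖K‖ := lt_of_le_of_ne (norm_nonneg _) (Ne.symm hne)
    nlinarith
  exact sub_eq_zero.1 (norm_eq_zero.1 h4)

end SquareRoot

/-! ### Local descriptions as level sets close to a plane -/

section LocalDescription

variable {n : ℕ}

/-- In the ball of radius `3r/2` about `x`, the set `M` is the preimage of the affine plane `x + V`
under the map `y ↦ y + ζ y`, where `ζ` is smooth, `‖ζ‖ ≤ c r`, `‖Dζ‖ ≤ c` and `‖D²ζ‖ ≤ c / r`. -/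
structure LocalDesc (c r : ℝ) (M : Set (EuclideanSpace ℝ (Fin n)))
    (x : EuclideanSpace ℝ (Fin n)) (V : Submodule ℝ (EuclideanSpace ℝ (Fin n)))
    (ζ : EuclideanSpace ℝ (Fin n) → EuclideanSpace ℝ (Fin n)) : Prop where
  contDiffOn : ContDiffOn ℝ ∞ ζ (Metric.ball x (3 / 2 * r))
  mem_iff : ∀ y ∈ Metric.ball x (3 / 2 * r), y ∈ M ↔ y + ζ y - x ∈ V
  norm_le : ∀ y ∈ Metric.ball x (3 / 2 * r), ‖ζ y‖ ≤ c * r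
  norm_fderiv_le : ∀ y ∈ Metric.ball x (3 / 2 * r), ‖fderiv ℝ ζ y‖ ≤ c
  norm_fderiv_fderiv_le : ∀ y ∈ Metric.ball x (3 / 2 * r), ‖fderiv ℝ (fderiv ℝ ζ) y‖ ≤ c / r

namespace LocalDesc

variable {c r : ℝ} {M : Set (EuclideanSpace ℝ (Fin n))} {x : EuclideanSpace ℝ (Fin n)}
  {V : Submodule ℝ (EuclideanSpace ℝ (Fin n))}
  {ζ : EuclideanSpace ℝ (Fin n) → EuclideanSpace ℝ (Fin n)}

theorem contDiffAt (h : LocalDesc c r M x V ζ) {y : EuclideanSpace ℝ (Fin n)}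
    (hy : y ∈ Metric.ball x (3 / 2 * r)) : ContDiffAt ℝ ∞ ζ y :=
  h.contDiffOn.contDiffAt (Metric.isOpen_ball.mem_nhds hy)

theorem hasFDerivAt (h : LocalDesc c r M x V ζ) {y : EuclideanSpace ℝ (Fin n)}
    (hy : y ∈ Metric.ball x (3 / 2 * r)) :
    HasFDerivAt (fun y => y + ζ y)
      (ContinuousLinearMap.id ℝ (EuclideanSpace ℝ (Fin n)) + fderiv ℝ ζ y) y :=
  (hasFDerivAt_id y).add ((h.contDiffAt hy).differentiableAt (by simp)).hasFDerivAt

/-- Since `ζ` is a contraction, `y ↦ y + ζ y` is a homeomorphism of the ball onto an open set. As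
`ζ` is also small, the image contains a slightly smaller ball. -/
theorem exists_openPartialHomeomorph (hr : 0 < r) (hc : c ≤ 1 / 4) (h : LocalDesc c r M x V ζ) :
    ∃ e : OpenPartialHomeomorph (EuclideanSpace ℝ (Fin n)) (EuclideanSpace ℝ (Fin n)),
      e.source = Metric.ball x (3 / 2 * r) ∧ (∀ y, e y = y + ζ y) ∧
        Metric.ball x r ⊆ e.target := by
  have hx : x ∈ Metric.ball x (3 / 2 * r) := Metric.mem_ball_self (by positivity)
  have hc0 : 0 ≤ c := (norm_nonneg _).trans (h.norm_fderiv_le x hx)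
  lift c to NNReal using hc0
  have hc' : (c : ℝ) < 1 := by linarith
  have hA : ApproximatesLinearOn (fun y => y + ζ y)
      ((ContinuousLinearEquiv.refl ℝ (EuclideanSpace ℝ (Fin n)) :
        EuclideanSpace ℝ (Fin n) ≃L[ℝ] EuclideanSpace ℝ (Fin n)) :
        EuclideanSpace ℝ (Fin n) →L[ℝ] EuclideanSpace ℝ (Fin n))
      (Metric.ball x (3 / 2 * r)) c := by
    intro y hy z hz
    have := (convex_ball x (3 / 2 * r)).norm_image_sub_le_of_norm_fderiv_le (𝕜 := ℝ)
      (fun w hw => (h.contDiffAt hw).differentiableAt (by simp)) h.norm_fderiv_le hz hy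
    refine le_trans (le_of_eq ?_) this
    congr 1
    simp only [ContinuousLinearEquiv.coe_refl, ContinuousLinearMap.id_apply]
    abel
  have hN : Subsingleton (EuclideanSpace ℝ (Fin n)) ∨
      c < ‖((ContinuousLinearEquiv.refl ℝ (EuclideanSpace ℝ (Fin n))).symm :
        EuclideanSpace ℝ (Fin n) →L[ℝ] EuclideanSpace ℝ (Fin n))‖₊⁻¹ := by
    rcases subsingleton_or_nontrivial (EuclideanSpace ℝ (Fin n)) with hs | hs
    · exact Or.inl hs
    · right
      have : ‖((ContinuousLinearEquiv.refl ℝ (EuclideanSpace ℝ (Fin n))).symm :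
        EuclideanSpace ℝ (Fin n) →L[ℝ] EuclideanSpace ℝ (Fin n))‖₊ = 1 := by
        ext
        simp
      rw [this, inv_one]
      exact_mod_cast hc'
  refine ⟨hA.toOpenPartialHomeomorph _ _ hN Metric.isOpen_ball, rfl, fun y => rfl, fun z hz => ?_⟩
  rw [Metric.mem_ball] at hz
  have hball : Metric.closedBall z (r / 2) ⊆ Metric.ball x (3 / 2 * r) := fun w hw => by
    rw [Metric.mem_closedBall] at hw
    rw [Metric.mem_ball]
    linarith [dist_triangle w z x]
  let inv : ((ContinuousLinearEquiv.refl ℝ (EuclideanSpace ℝ (Fin n)) :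
        EuclideanSpace ℝ (Fin n) ≃L[ℝ] EuclideanSpace ℝ (Fin n)) :
        EuclideanSpace ℝ (Fin n) →L[ℝ] EuclideanSpace ℝ (Fin n)).NonlinearRightInverse :=
    { toFun := id
      nnnorm := 1
      bound' := fun y => by simp
      right_inv' := fun y => by simp }
  have hsurj := hA.surjOn_closedBall_of_nonlinearRightInverse inv (ε := r / 2) (b := z)
    (by positivity) hball
  have hzmem : z ∈ Metric.closedBall (z + ζ z) ((((1 : NNReal) : ℝ)⁻¹ - c) * (r / 2)) := by
    have h1 := h.norm_le z (hball (Metric.mem_closedBall_self (by positivity)))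
    rw [Metric.mem_closedBall, dist_eq_norm]
    have : z - (z + ζ z) = -ζ z := by abel
    rw [this, norm_neg]
    refine h1.trans ?_
    push_cast
    nlinarith
  obtain ⟨y, hy, hyz⟩ := hsurj hzmem
  exact ⟨y, hball hy, hyz⟩

/-- A smooth submanifold chart: the inverse of `y ↦ y + ζ y`, restricted to `x + V`. -/
theorem exists_localParam (hr : 0 < r) (hc : c ≤ 1 / 4) (h : LocalDesc c r M x V ζ) {k : ℕ}
    (hV : Module.finrank ℝ V = k) :
    ∃ φ : LocalParam k M, φ.nhd = Metric.ball x (3 / 2 * r) := by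
  obtain ⟨e, hes, hey, -⟩ := h.exists_openPartialHomeomorph hr hc
  let ι : EuclideanSpace ℝ (Fin k) ≃ₗᵢ[ℝ] V :=
    (LinearIsometryEquiv.piLpCongrLeft 2 ℝ ℝ (finCongr hV.symm)).trans
      (stdOrthonormalBasis ℝ V).repr.symm
  let j : EuclideanSpace ℝ (Fin k) →L[ℝ] EuclideanSpace ℝ (Fin n) :=
    V.subtypeL.comp (ι : EuclideanSpace ℝ (Fin k) →L[ℝ] V)
  have hj : Function.Injective j := Subtype.coe_injective.comp ι.injective
  have hjmem : ∀ u, j u ∈ V := fun u => (ι u).2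
  have hjsurj : ∀ v ∈ V, j (ι.symm (V.orthogonalProjectionOnto v)) = v := fun v hv => by
    simp [j, Submodule.starProjection_eq_self_iff.2 hv]
  have haff : ContDiff ℝ ∞ (fun u => x + j u) := contDiff_const.add j.contDiff
  have hsmooth : ∀ z ∈ e.target, ContDiffAt ℝ ∞ e.symm z := by
    intro z hz
    have hy : e.symm z ∈ Metric.ball x (3 / 2 * r) := hes ▸ e.map_target hz
    have hDζ := h.norm_fderiv_le _ hy
    have hfd := h.hasFDerivAt hy
    have hinj : Function.Injective (ContinuousLinearMap.id ℝ (EuclideanSpace ℝ (Fin n)) +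
        fderiv ℝ ζ (e.symm z) : EuclideanSpace ℝ (Fin n) →ₗ[ℝ] EuclideanSpace ℝ (Fin n)) := by
      rw [injective_iff_map_eq_zero]
      intro w hw
      have h1 : w = -fderiv ℝ ζ (e.symm z) w := by
        rw [eq_neg_iff_add_eq_zero]; simpa using hw
      have h2 : ‖w‖ ≤ c * ‖w‖ := by
        calc ‖w‖ = ‖fderiv ℝ ζ (e.symm z) w‖ := by conv_lhs => rw [h1, norm_neg]
          _ ≤ c * ‖w‖ := (fderiv ℝ ζ (e.symm z)).le_of_opNorm_le hDζ w
      have : ‖w‖ = 0 := by nlinarith [norm_nonneg w]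
      exact norm_eq_zero.1 this
    let L := (LinearEquiv.ofInjectiveEndo _ hinj).toContinuousLinearEquiv
    refine e.contDiffAt_symm (f₀' := L) hz ?_ ?_
    · have : (e : EuclideanSpace ℝ (Fin n) → EuclideanSpace ℝ (Fin n)) = fun y => y + ζ y :=
        funext hey
      rw [this]
      refine hfd.congr_fderiv ?_
      ext1 v
      rfl
    · have : (e : EuclideanSpace ℝ (Fin n) → EuclideanSpace ℝ (Fin n)) = fun y => y + ζ y :=
        funext hey
      rw [this]
      exact contDiffAt_id.add (h.contDiffAt hy)
  have hright : ∀ u, x + j u ∈ e.target → e (e.symm (x + j u)) = x + j u :=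
    fun u hu => e.right_inv hu
  have hleft : ∀ u, x + j u ∈ e.target →
      ι.symm (V.orthogonalProjectionOnto (e (e.symm (x + j u)) - x)) = u := fun u hu => by
    rw [hright u hu, add_sub_cancel_left]
    exact hj (hjsurj _ (hjmem u))
  refine ⟨{
    toFun := fun u => e.symm (x + j u)
    inv := fun y => ι.symm (V.orthogonalProjectionOnto (e y - x))
    source := (fun u => x + j u) ⁻¹' e.target
    nhd := Metric.ball x (3 / 2 * r)
    isOpen_source := e.open_target.preimage haff.continuous
    isOpen_nhd := Metric.isOpen_ball
    contDiffOn := fun u hu => ((hsmooth _ hu).comp u haff.contDiffAt).contDiffWithinAt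
    injective_fderiv := ?_
    image_source := ?_
    left_inv := fun u hu => hleft u hu
    continuousOn_inv := ?_ }, rfl⟩
  · intro u hu
    have hd : DifferentiableAt ℝ (fun u => e.symm (x + j u)) u :=
      ((hsmooth _ hu).comp u haff.contDiffAt).differentiableAt (by simp)
    have hy : e.symm (x + j u) ∈ Metric.ball x (3 / 2 * r) := hes ▸ e.map_target hu
    have hcomp := (h.hasFDerivAt hy).comp u hd.hasFDerivAt
    have hcomp2 : HasFDerivAt ((fun y => y + ζ y) ∘ fun u => e.symm (x + j u)) j u := by
      refine (j.hasFDerivAt.const_add x).congr_of_eventuallyEq ?_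
      filter_upwards [(e.open_target.preimage haff.continuous).mem_nhds hu] with w hw
      simpa [hey] using hright w hw
    have heq := hcomp.unique hcomp2
    intro a b hab
    apply hj
    rw [← heq]
    simp only [ContinuousLinearMap.comp_apply, hab]
  · ext y
    constructor
    · rintro ⟨u, hu, rfl⟩
      have hy : e.symm (x + j u) ∈ Metric.ball x (3 / 2 * r) := hes ▸ e.map_target hu
      refine ⟨(h.mem_iff _ hy).2 ?_, hy⟩
      rw [← hey, hright u hu, add_sub_cancel_left]
      exact hjmem u
    · rintro ⟨hyM, hy⟩
      have hyV := (h.mem_iff _ hy).1 hyM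
      have hys : y ∈ e.source := hes ▸ hy
      have h1 : x + j (ι.symm (V.orthogonalProjectionOnto (y + ζ y - x))) = e y := by
        rw [hjsurj _ hyV, hey]; abel
      refine ⟨ι.symm (V.orthogonalProjectionOnto (y + ζ y - x)), ?_, ?_⟩
      · rw [Set.mem_preimage, h1]; exact e.map_source hys
      · simp only [h1, e.left_inv hys]
  · have hcont : ContinuousOn e (Metric.ball x (3 / 2 * r)) := hes ▸ e.continuousOn
    have : Continuous fun z => ι.symm (V.orthogonalProjectionOnto (z - x)) := by fun_prop
    exact this.comp_continuousOn (hcont.mono Set.inter_subset_right)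

theorem exists_mem_near (hr : 0 < r) (hc : c ≤ 1 / 4) (h : LocalDesc c r M x V ζ) :
    ∃ y ∈ M, dist x y ≤ c * r := by
  obtain ⟨e, hes, hey, het⟩ := h.exists_openPartialHomeomorph hr hc
  have hx : x ∈ e.target := het (Metric.mem_ball_self hr)
  have hy : e.symm x ∈ Metric.ball x (3 / 2 * r) := hes ▸ e.map_target hx
  have h1 : e.symm x + ζ (e.symm x) = x := by rw [← hey, e.right_inv hx]
  refine ⟨e.symm x, (h.mem_iff _ hy).2 (by rw [h1, sub_self]; exact V.zero_mem), ?_⟩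
  rw [dist_eq_norm]
  have : x - e.symm x = ζ (e.symm x) := sub_eq_of_eq_add' h1.symm
  rw [this]
  exact h.norm_le _ hy

/-- The connected piece is the image of a disc of radius `(1 - c) r` in `x + V`. -/
theorem exists_connected (hr : 0 < r) (hc : c ≤ 1 / 4) (h : LocalDesc c r M x V ζ) :
    ∃ G B : Set (EuclideanSpace ℝ (Fin n)), M ∩ Metric.ball x r = G ∪ B ∧ IsConnected G ∧
      B ⊆ Metric.ball x r \ Metric.ball x ((1 - 2 * c) * r) := by
  obtain ⟨e, hes, hey, het⟩ := h.exists_openPartialHomeomorph hr hc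
  have hc0 : 0 ≤ c := (norm_nonneg _).trans
    (h.norm_fderiv_le x (Metric.mem_ball_self (by positivity)))
  set D : Set (EuclideanSpace ℝ (Fin n)) := {z | z - x ∈ V} ∩ Metric.ball x ((1 - c) * r) with hD
  have hDt : D ⊆ e.target := fun z hz => het (Metric.ball_subset_ball (by nlinarith) hz.2)
  have hDc : Convex ℝ D := by
    refine Convex.inter ?_ (convex_ball _ _)
    have : {z | z - x ∈ V} = (fun z => z + -x) ⁻¹' (V : Set (EuclideanSpace ℝ (Fin n))) := by
      ext z; simp [sub_eq_add_neg]
    rw [this]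
    exact V.convex.translate_preimage_left (-x)
  have hDn : D.Nonempty := ⟨x, by simp, Metric.mem_ball_self (by nlinarith)⟩
  have hGconn : IsConnected (e.symm '' D) :=
    ⟨hDn.image _, hDc.isPreconnected.image _ (e.continuousOn_symm.mono hDt)⟩
  have hnear : ∀ y ∈ Metric.ball x (3 / 2 * r), dist y (e y) ≤ c * r := fun y hy => by
    rw [hey, dist_eq_norm]
    have : y - (y + ζ y) = -ζ y := by abel
    rw [this, norm_neg]
    exact h.norm_le y hy
  refine ⟨e.symm '' D, (M ∩ Metric.ball x r) \ Metric.ball x ((1 - 2 * c) * r), ?_, hGconn,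
    fun y hy => ⟨hy.1.2, hy.2⟩⟩
  ext y
  constructor
  · intro hy
    by_cases hyb : y ∈ Metric.ball x ((1 - 2 * c) * r)
    · left
      have hy' : y ∈ Metric.ball x (3 / 2 * r) := Metric.ball_subset_ball (by linarith) hy.2
      refine ⟨e y, ⟨?_, ?_⟩, e.left_inv (hes ▸ hy')⟩
      · rw [Set.mem_ofPred_eq, hey]
        exact (h.mem_iff y hy').1 hy.1
      · rw [Metric.mem_ball] at hyb ⊢
        have := hnear y hy'
        have h2 := dist_triangle_left (e y) x y
        nlinarith
    · exact Or.inr ⟨hy, hyb⟩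
  · rintro (⟨z, hz, rfl⟩ | hy)
    · have hzt := hDt hz
      have hy : e.symm z ∈ Metric.ball x (3 / 2 * r) := hes ▸ e.map_target hzt
      refine ⟨(h.mem_iff _ hy).2 ?_, ?_⟩
      · rw [← hey, e.right_inv hzt]; exact hz.1
      · have h1 := hnear _ hy
        rw [e.right_inv hzt] at h1
        have h2 := Metric.mem_ball.1 hz.2
        rw [Metric.mem_ball]
        linarith [dist_triangle (e.symm z) z x]
    · exact hy.1

end LocalDesc

end LocalDescription

/-! ### The second fundamental form -/

section SecondForm

variable {n k : ℕ} {M : Set (EuclideanSpace ℝ (Fin n))}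

open scoped MatrixOrder Matrix.Norms.L2Operator in
/-- If `g⁻¹ = Bᵀ B`, the vectors `∑ₐ B p a ∂ₐφ` form an orthonormal frame of the tangent space, and
`|A|²` is the sum of the squares `|A(eₚ, e_q)|²` over this frame. -/
theorem LocalParam.normSecondForm_le (φ : LocalParam k M) {u : EuclideanSpace ℝ (Fin k)}
    (hu : u ∈ φ.source) {K : ℝ} (hK : 0 ≤ K)
    (h : ∀ s t, ‖(φ.tangent u)ᗮ.starProjection (fderiv ℝ (fderiv ℝ φ.toFun) u s t)‖ ≤
      K * ‖fderiv ℝ φ.toFun u s‖ * ‖fderiv ℝ φ.toFun u t‖) :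
    φ.normSecondForm u ≤ k * K := by
  set J := fderiv ℝ φ.toFun u with hJ
  set e : Fin k → EuclideanSpace ℝ (Fin k) := fun i => EuclideanSpace.single i 1 with he
  have hli : LinearIndependent ℝ (fun i => J (e i)) := by
    have h1 : LinearIndependent ℝ e := by
      have h2 : e = EuclideanSpace.basisFun (Fin k) ℝ := funext fun i => by simp [he]
      rw [h2]
      exact (EuclideanSpace.basisFun (Fin k) ℝ).orthonormal.linearIndependent
    exact h1.map' (J : EuclideanSpace ℝ (Fin k) →ₗ[ℝ] EuclideanSpace ℝ (Fin n))
      (LinearMap.ker_eq_bot.2 (φ.injective_fderiv u hu))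
  have hg : (φ.metric u).PosDef := Matrix.posDef_gram_of_linearIndependent hli
  obtain ⟨B, hB⟩ := CStarAlgebra.nonneg_iff_eq_star_mul_self.1 hg.inv.posSemidef.nonneg
  rw [Matrix.star_eq_conjTranspose, Matrix.conjTranspose_eq_transpose_of_trivial] at hB
  have hBg : B * (φ.metric u * B.transpose) = 1 := by
    rw [mul_eq_one_comm, Matrix.mul_assoc, ← hB]
    exact Matrix.mul_nonsing_inv _ (Matrix.isUnit_iff_isUnit_det _ |>.1 hg.isUnit)
  set s : Fin k → EuclideanSpace ℝ (Fin k) := fun p => ∑ a, B p a • e a with hs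
  have hnorm : ∀ p, ‖J (s p)‖ = 1 := by
    intro p
    have h1 : ‖J (s p)‖ ^ 2 = 1 := by
      have h2 := congrFun (congrFun hBg p) p
      rw [Matrix.one_apply_eq] at h2
      rw [← h2, ← real_inner_self_eq_norm_sq, hs]
      simp only [map_sum, map_smul, sum_inner, inner_sum, real_inner_smul_left,
        real_inner_smul_right, Matrix.mul_apply, Finset.mul_sum, Matrix.transpose_apply]
      refine Finset.sum_congr rfl fun a _ => Finset.sum_congr rfl fun b _ => ?_
      simp only [LocalParam.metric, Matrix.of_apply, ← hJ, he]
      rw [real_inner_comm]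
      ring
    have h3 := norm_nonneg (J (s p))
    nlinarith
  have hsum : ∀ p q, ∑ a, ∑ b, (B p a * B q b) • φ.secondForm u a b =
      (φ.tangent u)ᗮ.starProjection (fderiv ℝ (fderiv ℝ φ.toFun) u (s p) (s q)) := by
    intro p q
    simp only [hs, map_sum, map_smul, sum_apply, smul_apply,
      Finset.smul_sum, smul_smul]
    rw [Finset.sum_comm]
    refine Finset.sum_congr rfl fun b _ => Finset.sum_congr rfl fun a _ => ?_
    rw [mul_comm]
    rfl
  have hBinv : ∀ a c, (φ.metric u)⁻¹ a c = ∑ p, B p a * B p c := by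
    intro a c
    rw [hB]
    rfl
  have key : (∑ a, ∑ b, ∑ c, ∑ d, (φ.metric u)⁻¹ a c * (φ.metric u)⁻¹ b d *
      inner ℝ (φ.secondForm u a b) (φ.secondForm u c d)) =
      ∑ p, ∑ q, ‖∑ a, ∑ b, (B p a * B q b) • φ.secondForm u a b‖ ^ 2 := by
    have pull : ∀ f : Fin k → Fin k → Fin k → Fin k → Fin k → ℝ,
        ∑ a, ∑ b, ∑ c, ∑ d, ∑ p, f a b c d p = ∑ p, ∑ a, ∑ b, ∑ c, ∑ d, f a b c d p := by
      intro f
      symm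
      rw [Finset.sum_comm]
      refine Finset.sum_congr rfl fun a _ => ?_
      rw [Finset.sum_comm]
      refine Finset.sum_congr rfl fun b _ => ?_
      rw [Finset.sum_comm]
      exact Finset.sum_congr rfl fun c _ => Finset.sum_comm
    simp only [← real_inner_self_eq_norm_sq, sum_inner, inner_sum, real_inner_smul_left,
      real_inner_smul_right, hBinv, Finset.sum_mul, Finset.mul_sum]
    rw [pull]
    refine (Finset.sum_congr rfl fun q _ => pull _).trans ?_
    rw [Finset.sum_comm]
    refine Finset.sum_congr rfl fun p _ => ?_
    refine Finset.sum_congr rfl fun q _ => Finset.sum_congr rfl fun a _ =>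
      Finset.sum_congr rfl fun b _ => Finset.sum_congr rfl fun c _ =>
      Finset.sum_congr rfl fun d _ => ?_
    rw [real_inner_comm]
    ring
  unfold LocalParam.normSecondForm
  rw [key]
  refine Real.sqrt_le_iff.2 ⟨by positivity, ?_⟩
  calc _ ≤ ∑ _p : Fin k, ∑ _q : Fin k, K ^ 2 := by
        refine Finset.sum_le_sum fun p _ => Finset.sum_le_sum fun q _ => ?_
        rw [hsum]
        refine pow_le_pow_left₀ (norm_nonneg _) ((h _ _).trans_eq ?_) 2
        rw [hnorm, hnorm]; ring
    _ = _ := by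
        simp only [Finset.sum_const, Finset.card_univ, Fintype.card_fin, nsmul_eq_mul]
        ring

/-- Differentiating `φ + ζ ∘ φ ∈ x + V` twice gives `(1 + Dζ) D²φ(s, t) + D²ζ(Dφ s, Dφ t) ∈ V`.
Since `1 + Dζ` maps the tangent space onto `V`, the component of `D²φ(s, t)` normal to the tangent
space is controlled by `D²ζ`. -/
theorem LocalDesc.norm_starProjection_le {c r : ℝ} {x : EuclideanSpace ℝ (Fin n)}
    {V : Submodule ℝ (EuclideanSpace ℝ (Fin n))}
    {ζ : EuclideanSpace ℝ (Fin n) → EuclideanSpace ℝ (Fin n)} (hc : c ≤ 1 / 4)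
    (h : LocalDesc c r M x V ζ) (hV : Module.finrank ℝ V = k) (φ : LocalParam k M)
    {u : EuclideanSpace ℝ (Fin k)} (hu : u ∈ φ.source)
    (hux : φ.toFun u ∈ Metric.ball x (3 / 2 * r)) (s t : EuclideanSpace ℝ (Fin k)) :
    ‖(φ.tangent u)ᗮ.starProjection (fderiv ℝ (fderiv ℝ φ.toFun) u s t)‖ ≤
      2 * (c / r) * ‖fderiv ℝ φ.toFun u s‖ * ‖fderiv ℝ φ.toFun u t‖ := by
  set P := Vᗮ.starProjection with hP
  have hPV : ∀ v ∈ V, P v = 0 := fun v hv => by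
    rw [hP, Submodule.starProjection_apply_eq_zero_iff, Submodule.orthogonal_orthogonal]; exact hv
  have hφat : ∀ w ∈ φ.source, ContDiffAt ℝ ∞ φ.toFun w := fun w hw =>
    φ.contDiffOn.contDiffAt (φ.isOpen_source.mem_nhds hw)
  have hopen : ∀ᶠ w in nhds u, w ∈ φ.source ∧ φ.toFun w ∈ Metric.ball x (3 / 2 * r) :=
    Filter.Eventually.and (φ.isOpen_source.mem_nhds hu)
      ((hφat u hu).continuousAt.preimage_mem_nhds (Metric.isOpen_ball.mem_nhds hux))
  have hzero : ∀ᶠ w in nhds u, P (φ.toFun w + ζ (φ.toFun w) - x) = 0 := by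
    filter_upwards [hopen] with w hw
    have hM : φ.toFun w ∈ M := (φ.image_source ▸ Set.mem_image_of_mem _ hw.1 :
      φ.toFun w ∈ M ∩ φ.nhd).1
    exact hPV _ ((h.mem_iff _ hw.2).1 hM)
  -- The first derivative of the defining equation, near `u`.
  have hfirst : ∀ᶠ w in nhds u, ∀ t, P (fderiv ℝ φ.toFun w t +
      fderiv ℝ ζ (φ.toFun w) (fderiv ℝ φ.toFun w t)) = 0 := by
    filter_upwards [hopen, hzero.eventually_nhds] with w hw hw0 t
    have hd : HasFDerivAt φ.toFun (fderiv ℝ φ.toFun w) w :=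
      ((hφat w hw.1).differentiableAt (by simp)).hasFDerivAt
    have h1 := P.hasFDerivAt.comp w (((h.hasFDerivAt hw.2).comp w hd).sub_const x)
    have h2 : HasFDerivAt (fun w => P (φ.toFun w + ζ (φ.toFun w) - x))
        (0 : EuclideanSpace ℝ (Fin k) →L[ℝ] EuclideanSpace ℝ (Fin n)) w :=
      (hasFDerivAt_const _ _).congr_of_eventuallyEq hw0
    have h3 := congrArg (fun L => L t) (h1.unique h2)
    simpa using h3
  -- The second derivative of the defining equation, at `u`.
  have hsecond : P (fderiv ℝ (fderiv ℝ φ.toFun) u s t +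
      (fderiv ℝ (fderiv ℝ ζ) (φ.toFun u) (fderiv ℝ φ.toFun u s) (fderiv ℝ φ.toFun u t) +
        fderiv ℝ ζ (φ.toFun u) (fderiv ℝ (fderiv ℝ φ.toFun) u s t))) = 0 := by
    have hd : HasFDerivAt φ.toFun (fderiv ℝ φ.toFun u) u :=
      ((hφat u hu).differentiableAt (by simp)).hasFDerivAt
    have hdd : HasFDerivAt (fderiv ℝ φ.toFun) (fderiv ℝ (fderiv ℝ φ.toFun) u) u :=
      (((hφat u hu).fderiv_right (m := ∞) (by simp)).differentiableAt
        (by simp)).hasFDerivAt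
    have hζ : HasFDerivAt (fderiv ℝ ζ) (fderiv ℝ (fderiv ℝ ζ) (φ.toFun u)) (φ.toFun u) :=
      (((h.contDiffAt hux).fderiv_right (m := ∞) (by simp)).differentiableAt
        (by simp)).hasFDerivAt
    have h1 := hdd.clm_apply (hasFDerivAt_const t u)
    have h2 := (hζ.comp u hd).clm_apply h1
    have h3 := P.hasFDerivAt.comp u (h1.add h2)
    have h4 := h3.unique ((hasFDerivAt_const (0 : EuclideanSpace ℝ (Fin n)) u).congr_of_eventuallyEq
      (hfirst.mono fun w hw => hw t))
    have h5 := congrArg (fun L => L s) h4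
    simp only [ContinuousLinearMap.comp_apply, add_apply,
      ContinuousLinearMap.flip_apply, zero_apply, Function.comp_apply,
      map_zero, zero_add] at h5
    rw [← h5]
    congr 2
    abel
  set D := fderiv ℝ ζ (φ.toFun u) with hD
  have hDc : ‖D‖ ≤ c := h.norm_fderiv_le _ hux
  set T := φ.tangent u with hT
  set b := fderiv ℝ (fderiv ℝ φ.toFun) u s t with hb
  set q := fderiv ℝ (fderiv ℝ ζ) (φ.toFun u) (fderiv ℝ φ.toFun u s) (fderiv ℝ φ.toFun u t) with hq
  have hqle : ‖q‖ ≤ c / r * ‖fderiv ℝ φ.toFun u s‖ * ‖fderiv ℝ φ.toFun u t‖ :=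
    (ContinuousLinearMap.le_opNorm₂ _ _ _).trans
      (by gcongr; exact h.norm_fderiv_fderiv_le _ hux)
  set ν := Tᗮ.starProjection b with hν
  have hνT : ∀ τ ∈ T, inner ℝ τ ν = 0 := fun τ hτ =>
    (Submodule.mem_orthogonal T ν).1 (Submodule.starProjection_apply_mem Tᗮ b) τ hτ
  have hlow : ∀ w, (1 - c) * ‖w‖ ≤ ‖w + D w‖ := fun w => by
    have h1 := D.le_of_opNorm_le hDc w
    have h2 : ‖w‖ ≤ ‖w + D w‖ + ‖D w‖ := norm_le_add_norm_add _ _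
    linarith
  have hTV : ∀ τ ∈ T, τ + D τ ∈ V := by
    rintro τ ⟨a, rfl⟩
    have := hfirst.self_of_nhds a
    rwa [hP, Submodule.starProjection_apply_eq_zero_iff, Submodule.orthogonal_orthogonal] at this
  let L : T →ₗ[ℝ] V :=
    { toFun := fun τ => ⟨(τ : EuclideanSpace ℝ (Fin n)) + D τ, hTV _ τ.2⟩
      map_add' := fun a b => by ext1; simp; abel
      map_smul' := fun a b => by ext1; simp }
  have hLinj : Function.Injective L := by
    rw [injective_iff_map_eq_zero]
    intro τ hτ
    have h0 : (τ : EuclideanSpace ℝ (Fin n)) + D τ = 0 := congrArg Subtype.val hτ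
    have h1 := hlow τ
    rw [h0, norm_zero] at h1
    have : ‖(τ : EuclideanSpace ℝ (Fin n))‖ = 0 := by
      nlinarith [norm_nonneg (τ : EuclideanSpace ℝ (Fin n))]
    exact Subtype.ext (norm_eq_zero.1 this)
  have hTk : Module.finrank ℝ T = Module.finrank ℝ V := by
    rw [hV, hT, LocalParam.tangent, LinearMap.finrank_range_of_inj (φ.injective_fderiv u hu)]
    simp
  have hLsurj := (LinearMap.injective_iff_surjective_of_finrank_eq_finrank hTk).1 hLinj
  have hVcompl : ∀ m, m - P m ∈ V := fun m => by
    rw [hP, Submodule.starProjection_orthogonal_val, sub_sub_cancel]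
    exact Submodule.starProjection_apply_mem V m
  -- Subtract from `ν` the tangent vector that `1 + Dζ` maps to the `V`-component of `(1 + Dζ) ν`.
  -- Being orthogonal to `τ`, the vector `ν` is not longer than `ν - τ`.
  obtain ⟨τ, hτ⟩ := hLsurj ⟨ν + D ν - P (ν + D ν), hVcompl _⟩
  have hτ' : (τ : EuclideanSpace ℝ (Fin n)) + D τ = ν + D ν - P (ν + D ν) := congrArg Subtype.val hτ
  have hPν : P (ν + D ν) = - P q := by
    have hbν : b - ν ∈ T := by
      rw [hν, Submodule.starProjection_orthogonal_val, sub_sub_cancel]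
      exact Submodule.starProjection_apply_mem T b
    have h1 := hPV _ (hTV _ hbν)
    have h2 : ν + D ν = (b + (q + D b)) - q - (b - ν + D (b - ν)) := by
      rw [map_sub]; abel
    rw [h2, map_sub, map_sub, hsecond, h1]
    simp
  have hdiff : ‖(ν - τ) + D (ν - τ)‖ ≤ ‖q‖ := by
    have h1 : (ν - τ) + D (ν - τ) = -P q := by
      rw [map_sub]
      have : ν - (τ : EuclideanSpace ℝ (Fin n)) + (D ν - D τ) = (ν + D ν) - (τ + D τ) := by abel
      rw [this, hτ', sub_sub_cancel, hPν]
    rw [h1, norm_neg]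
    exact Submodule.norm_starProjection_apply_le _ _
  have hpyth : ‖ν‖ ≤ ‖ν - τ‖ := by
    have h1 : ‖ν - τ‖ * ‖ν - τ‖ = ‖ν‖ * ‖ν‖ +
        ‖(τ : EuclideanSpace ℝ (Fin n))‖ * ‖(τ : EuclideanSpace ℝ (Fin n))‖ :=
      norm_sub_sq_eq_norm_sq_add_norm_sq_real (by rw [real_inner_comm]; exact hνT _ τ.2)
    nlinarith [norm_nonneg ν, norm_nonneg (ν - τ), norm_nonneg (τ : EuclideanSpace ℝ (Fin n))]
  have h1 := hlow (ν - τ)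
  have h2 := norm_nonneg (ν - τ)
  nlinarith

end SecondForm

/-! ### Separated nets and weighted sums -/

section Nets

variable {n : ℕ}

theorem IsCompact.exists_finset_separated {X : Type*} [PseudoMetricSpace X] {s : Set X}
    (hs : IsCompact s) :
    ∃ t : Finset X, (t : Set X) ⊆ s ∧ (∀ p ∈ t, ∀ q ∈ t, p ≠ q → 2 ≤ dist p q) ∧
      ∀ x ∈ s, ∃ p ∈ t, dist x p ≤ 2 := by
  have hfin : Metric.packingNumber (2 : NNReal) s ≠ ⊤ := by
    obtain ⟨N, -, hN, hcov⟩ := Metric.exists_finite_isCover_of_isCompact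
      (one_ne_zero : (1 : NNReal) ≠ 0) hs
    have h1 := Metric.packingNumber_two_mul_le_externalCoveringNumber 1 s
    rw [mul_one] at h1
    exact ne_top_of_le_ne_top hN.encard_lt_top.ne
      (h1.trans hcov.externalCoveringNumber_le_encard)
  have hsep := Metric.isSeparated_maximalSeparatedSet (ε := 2) (A := s)
  have hfinite : (Metric.maximalSeparatedSet (2 : NNReal) s).Finite := by
    rw [← Set.encard_ne_top_iff, Metric.encard_maximalSeparatedSet hfin]
    exact hfin
  refine ⟨hfinite.toFinset, by simpa using Metric.maximalSeparatedSet_subset,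
    fun p hp q hq hpq => ?_, fun x hx => ?_⟩
  · have h1 : ((2 : NNReal) : ENNReal) < edist p q := hsep (by simpa using hp) (by simpa using hq) hpq
    rw [edist_dist] at h1
    have h2 := (ENNReal.lt_ofReal_iff_toReal_lt (by simp)).1 h1
    simpa using h2.le
  · obtain ⟨p, hp, hxp⟩ := Metric.isCover_maximalSeparatedSet hfin hx
    refine ⟨p, by simpa using hp, ?_⟩
    have h1 : edist x p ≤ (2 : NNReal) := hxp
    rw [edist_dist] at h1
    simpa using (ENNReal.ofReal_le_iff_le_toReal (by simp)).1 h1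

/-- At most `5ⁿ` points of a `2`-separated set lie in a ball of radius `4`. -/
theorem card_filter_le_of_separated {t : Finset (EuclideanSpace ℝ (Fin n))}
    (ht : ∀ p ∈ t, ∀ q ∈ t, p ≠ q → 2 ≤ dist p q) (y : EuclideanSpace ℝ (Fin n)) :
    (t.filter fun p => dist y p ≤ 4).card ≤ 5 ^ n := by
  classical
  let f : EuclideanSpace ℝ (Fin n) → EuclideanSpace ℝ (Fin n) := fun p => (1 / 2 : ℝ) • (p - y)
  have hf : Function.Injective f := fun p q h => by simpa [f] using h
  have hdist : ∀ p q, ‖f p - f q‖ = 1 / 2 * dist p q := fun p q => by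
    simp only [f, ← smul_sub, sub_sub_sub_cancel_right, norm_smul, dist_eq_norm]
    norm_num
  rw [← Finset.card_image_of_injective _ hf]
  have h := Besicovitch.card_le_of_separated ((t.filter fun p => dist y p ≤ 4).image f) ?_ ?_
  · simpa using h
  · intro c hc
    obtain ⟨p, hp, rfl⟩ := Finset.mem_image.1 hc
    have h1 := hdist p y
    have h2 : f y = 0 := by simp [f]
    have h3 := (Finset.mem_filter.1 hp).2
    rw [h2, sub_zero, dist_comm] at h1
    linarith
  · intro c hc d hd hcd
    obtain ⟨p, hp, rfl⟩ := Finset.mem_image.1 hc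
    obtain ⟨q, hq, rfl⟩ := Finset.mem_image.1 hd
    have := ht p (Finset.mem_filter.1 hp).1 q (Finset.mem_filter.1 hq).1
      (fun h => hcd (by rw [h]))
    rw [hdist]
    linarith

/-- A bump function equal to `1` on the ball of radius `7/2` and supported in the ball of
radius `4`. -/
noncomputable def netBump (n : ℕ) : ContDiffBump (0 : EuclideanSpace ℝ (Fin n)) where
  rIn := 7 / 2
  rOut := 4
  rIn_pos := by norm_num
  rIn_lt_rOut := by norm_num

theorem exists_netBump_bound (n : ℕ) :
    ∃ C > 0, ∀ i ≤ 2, ∀ y, ‖iteratedFDeriv ℝ i (netBump n) y‖ ≤ C := by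
  have hb : ∀ i : ℕ, ∃ c, ∀ y, ‖iteratedFDeriv ℝ i (netBump n) y‖ ≤ c := fun i =>
    ((netBump n).hasCompactSupport.iteratedFDeriv (𝕜 := ℝ) i).exists_bound_of_continuous
      (((netBump n).contDiff (n := ⊤)).continuous_iteratedFDeriv (by exact_mod_cast le_top))
  choose c hc using hb
  refine ⟨max (c 0) 0 + max (c 1) 0 + max (c 2) 0 + 1, by positivity, fun i hi y => ?_⟩
  have h2 := hc i y
  have n0 := le_max_left (c 0) 0
  have n1 := le_max_left (c 1) 0
  have n2 := le_max_left (c 2) 0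
  have p0 := le_max_right (c 0) 0
  have p1 := le_max_right (c 1) 0
  have p2 := le_max_right (c 2) 0
  interval_cases i <;> linarith

theorem iteratedFDeriv_netBump_eq_zero (i : ℕ) {y : EuclideanSpace ℝ (Fin n)} (hy : 4 < ‖y‖) :
    iteratedFDeriv ℝ i (netBump n) y = 0 := by
  apply image_eq_zero_of_notMem_tsupport
  intro h
  have := tsupport_iteratedFDeriv_subset i h
  rw [(netBump n).tsupport_eq, mem_closedBall_zero_iff] at this
  exact absurd this (not_le.2 hy)

/-- Sums over a separated net with bump function weights: at each point at most `5ⁿ` terms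
contribute, so the bound does not depend on the size of the net. -/
theorem c2Bound_sum_netBump {F : Type*} [NormedAddCommGroup F] [NormedSpace ℝ F]
    {t : Finset (EuclideanSpace ℝ (Fin n))}
    (ht : ∀ p ∈ t, ∀ q ∈ t, p ≠ q → 2 ≤ dist p q) {C : ℝ}
    (hC : ∀ i ≤ 2, ∀ y, ‖iteratedFDeriv ℝ i (netBump n) y‖ ≤ C)
    {U : Set (EuclideanSpace ℝ (Fin n))} (hU : IsOpen U) {a : ℝ} (ha : 0 ≤ a)
    (v : EuclideanSpace ℝ (Fin n) → F)
    (hv : ∀ p ∈ t, ∀ y ∈ U, dist y p ≤ 4 → ‖v p‖ ≤ a) :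
    C2Bound (5 ^ n * (C * a)) U (fun y => ∑ p ∈ t, netBump n (y - p) • v p) := by
  have hC0 : 0 ≤ C := (norm_nonneg _).trans (hC 0 (by norm_num) 0)
  have hsm : ∀ p, ContDiff ℝ ∞ (fun y => netBump n (y - p)) := fun p =>
    (netBump n).contDiff.comp (contDiff_id.sub contDiff_const)
  have hterm : ∀ p, ContDiff ℝ ∞ (fun y => netBump n (y - p) • v p) := fun p =>
    (hsm p).smul contDiff_const
  refine ⟨(ContDiff.sum fun p _ => hterm p).contDiffOn, fun i hi y hy => ?_⟩
  rw [iteratedFDerivWithin_fun_sum_apply hU.uniqueDiffOn hy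
    fun p _ => ((hterm p).contDiffWithinAt.of_le (by exact_mod_cast le_top))]
  have hone : ∀ p, ‖iteratedFDerivWithin ℝ i (fun y => netBump n (y - p) • v p) U y‖ ≤
      ‖v p‖ * ‖iteratedFDeriv ℝ i (netBump n) (y - p)‖ := fun p => by
    have h := (ContinuousLinearMap.toSpanSingleton ℝ (v p)).norm_iteratedFDerivWithin_comp_left
      (hsm p).contDiffWithinAt hU.uniqueDiffOn hy (n := i) (by exact_mod_cast le_top)
    rw [iteratedFDerivWithin_of_isOpen i hU hy (f := fun y => netBump n (y - p)),
      iteratedFDeriv_comp_sub, ContinuousLinearMap.norm_toSpanSingleton] at h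
    exact h
  calc _ ≤ ∑ p ∈ t, ‖v p‖ * ‖iteratedFDeriv ℝ i (netBump n) (y - p)‖ :=
        norm_sum_le_of_le _ fun p _ => hone p
    _ = ∑ p ∈ t.filter fun p => dist y p ≤ 4,
          ‖v p‖ * ‖iteratedFDeriv ℝ i (netBump n) (y - p)‖ := by
        rw [Finset.sum_filter_of_ne]
        intro p _ hne
        by_contra hlt
        rw [not_le, dist_eq_norm] at hlt
        exact hne (by rw [iteratedFDeriv_netBump_eq_zero i hlt]; simp)
    _ ≤ ∑ p ∈ t.filter fun p => dist y p ≤ 4, a * C := by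
        refine Finset.sum_le_sum fun p hp => ?_
        obtain ⟨hpt, hyp⟩ := Finset.mem_filter.1 hp
        exact mul_le_mul (hv p hpt y hy hyp) (hC i hi _) (norm_nonneg _) ha
    _ ≤ _ := by
        rw [Finset.sum_const, nsmul_eq_mul, mul_comm a C]
        gcongr
        exact_mod_cast card_filter_le_of_separated ht y

end Nets

/-! ### Fields of planes approximating a set -/

section PlaneFields

variable {n : ℕ}

/-- The planes `x + V x`, `x ∈ X`, approximate `X` up to `ε r` from both sides at scale `r`: discs
of radius `2 r` in them are close to `X`, and `X` is close to them in balls of radius `9 r`. -/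
structure PlaneField (ε r : ℝ) (X : Set (EuclideanSpace ℝ (Fin n)))
    (V : EuclideanSpace ℝ (Fin n) → Submodule ℝ (EuclideanSpace ℝ (Fin n))) : Prop where
  exists_near : ∀ x ∈ X, ∀ p ∈ V x, ‖p‖ ≤ 2 * r → ∃ q ∈ X, dist q (x + p) ≤ ε * r
  norm_proj_le : ∀ x ∈ X, ∀ q ∈ X, dist q x < 9 * r →
    ‖(V x)ᗮ.starProjection (q - x)‖ ≤ ε * r

/-- Nearby planes make a small angle. With `p`, `q` the orthogonal projections,
`p - q = p (1 - q) - (1 - p) q`, and both products are controlled by one-sided closeness, the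
second one through its adjoint. -/
theorem PlaneField.norm_starProjection_sub_le {ε : ℝ} {X : Set (EuclideanSpace ℝ (Fin n))}
    {V : EuclideanSpace ℝ (Fin n) → Submodule ℝ (EuclideanSpace ℝ (Fin n))}
    (h : PlaneField ε 1 X V) (hε : ε ≤ 1) {x x' : EuclideanSpace ℝ (Fin n)} (hx : x ∈ X)
    (hx' : x' ∈ X) (hd : dist x x' ≤ 11 / 2) :
    ‖(V x')ᗮ.starProjection - (V x)ᗮ.starProjection‖ ≤ 6 * ε := by
  have hε0 : 0 ≤ ε := by
    have := (norm_nonneg _).trans (h.norm_proj_le x hx x hx (by simp))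
    linarith
  have one : ∀ x ∈ X, ∀ x' ∈ X, dist x x' ≤ 11 / 2 →
      ‖(V x')ᗮ.starProjection * (1 - (V x)ᗮ.starProjection)‖ ≤ 3 * ε := by
    intro x hx x' hx' hd
    have hunit : ∀ p ∈ V x, ‖p‖ ≤ 1 → ‖(V x')ᗮ.starProjection p‖ ≤ 3 * ε := by
      intro p hp hp1
      obtain ⟨q, hq, hqp⟩ := h.exists_near x hx p hp (by linarith)
      have hqx' : dist q x' < 9 := by
        have h1 := dist_triangle4 q (x + p) x x'
        have h2 : dist (x + p) x = ‖p‖ := by simp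
        linarith
      have e1 := h.norm_proj_le x' hx' q hq (by linarith)
      have e2 := h.norm_proj_le x' hx' x hx (by linarith)
      have e3 := (V x')ᗮ.norm_starProjection_apply_le (q - (x + p))
      rw [← dist_eq_norm] at e3
      have : p = (q - x') - (x - x') - (q - (x + p)) := by abel
      rw [this, map_sub, map_sub]
      refine (norm_sub_le _ _).trans ?_
      have := norm_sub_le ((V x')ᗮ.starProjection (q - x')) ((V x')ᗮ.starProjection (x - x'))
      linarith
    refine ContinuousLinearMap.opNorm_le_bound _ (by positivity) fun w => ?_
    set p := (V x).starProjection w with hp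
    have hpe : ((V x')ᗮ.starProjection * (1 - (V x)ᗮ.starProjection)) w =
        (V x')ᗮ.starProjection p := by
      rw [mul_apply_eq_comp]
      congr 1
      rw [sub_apply, one_apply_eq_self, Submodule.starProjection_orthogonal_val,
        sub_sub_cancel]
    rw [hpe]
    have hpw : ‖p‖ ≤ ‖w‖ := (V x).norm_starProjection_apply_le w
    have hpm : p ∈ V x := Submodule.starProjection_apply_mem _ _
    rcases eq_or_ne p 0 with h0 | h0
    · rw [h0, map_zero, norm_zero]; positivity
    have hpos : 0 < ‖p‖ := norm_pos_iff.2 h0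
    have h1 := hunit (‖p‖⁻¹ • p) ((V x).smul_mem _ hpm) (by
      rw [norm_smul, norm_inv, norm_norm, inv_mul_cancel₀ hpos.ne'])
    rw [map_smul, norm_smul, norm_inv, norm_norm, inv_mul_le_iff₀ hpos] at h1
    nlinarith
  have h1 := one x hx x' hx' hd
  have h2 := one x' hx' x hx (by rwa [dist_comm])
  set p := (V x')ᗮ.starProjection
  set q := (V x)ᗮ.starProjection
  have hp : star p = p := isSelfAdjoint_starProjection _
  have hq : star q = q := isSelfAdjoint_starProjection _
  have h3 : ‖(1 - p) * q‖ ≤ 3 * ε := by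
    rw [← norm_star, star_mul, star_sub, star_one, hp, hq]
    exact h2
  have h4 : p - q = p * (1 - q) - (1 - p) * q := by noncomm_ring
  rw [h4]
  refine (norm_sub_le _ _).trans ?_
  linarith

/-- If `C² = S²` with `C` near `1`, then `Q = (C + S)/2` satisfies `Q² = C Q`: it is an invertible
multiple of the projection to the part of the spectrum where `S` is positive. Therefore every `P`
close to `Q` is injective on the range of `Q`: if `w` lies in that range and `P w = 0`, then
`C w = Q w = (Q - P) w`, where `C` is close to `1` and `Q - P` is small. -/
theorem eq_zero_of_apply_eq_zero {E : Type*} [NormedAddCommGroup E] [NormedSpace ℝ E]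
    {C S P : E →L[ℝ] E} (hCS : C * C = S * S) (hC : ‖C - 1‖ ≤ 1 / 4)
    (hP : ‖(1 / 2 : ℝ) • (C + S) - P‖ ≤ 1 / 4) {v : E}
    (hv : P (((1 / 2 : ℝ) • (C + S)) v) = 0) : ((1 / 2 : ℝ) • (C + S)) v = 0 := by
  set Q := (1 / 2 : ℝ) • (C + S) with hQ
  have hcomm : S * C = C * S := commute_of_commute_mul_self (by linarith) (by
    rw [hCS, mul_assoc])
  have hQQ : Q * Q = C * Q := by
    have h1 : (C + S) * (C + S) = (2 : ℝ) • (C * (C + S)) := by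
      rw [add_mul, mul_add, mul_add, hcomm, ← hCS, two_smul]
      abel
    rw [hQ, smul_mul_smul_comm, h1, mul_smul_comm, smul_smul]
    norm_num
  set w := Q v with hw
  have h1 : C w = (Q - P) w := by
    rw [sub_apply, hv, sub_zero, hw]
    exact (congrArg (fun L => L v) hQQ).symm
  have h2 : ‖C w‖ ≤ 1 / 4 * ‖w‖ := by
    rw [h1]
    exact (Q - P).le_of_opNorm_le hP w
  have h3 : ‖(C - 1) w‖ ≤ 1 / 4 * ‖w‖ := (C - 1).le_of_opNorm_le hC w
  have h4 : w = C w - (C - 1) w := by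
    rw [sub_apply, one_apply_eq_self, sub_sub_cancel]
  have h5 : ‖w‖ ≤ ‖C w‖ + ‖(C - 1) w‖ := by
    conv_lhs => rw [h4]
    exact norm_sub_le _ _
  have : ‖w‖ = 0 := by linarith [norm_nonneg w]
  exact norm_eq_zero.1 this

/-- The smooth substitute for a spectral projection. Near a projection `P` the map
`q T = (√((2T - 1)²) + (2T - 1)) / 2` is `C²`-close to `P`, and `P` is injective on the range of
`q T`. -/
theorem exists_spectral_map (E F : Type*) [NormedAddCommGroup E] [NormedSpace ℝ E]
    [NormedAddCommGroup F] [NormedSpace ℝ F] [CompleteSpace F] :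
    ∃ q : (F →L[ℝ] F) → (F →L[ℝ] F), ∀ η > 0, ∃ a > 0, ∀ P : F →L[ℝ] F, P * P = P → ‖P‖ ≤ 1 →
      ∀ U : Set E, IsOpen U → ∀ α : E → F →L[ℝ] F, C2Bound a U α →
        C2Bound η U (fun y => q (P + α y) - P) ∧
          ∀ y ∈ U, ∀ v, P (q (P + α y) v) = 0 → q (P + α y) v = 0 := by
  obtain ⟨s, hs1, hsmooth, hssq⟩ := exists_contDiffAt_sqrt (A := F →L[ℝ] F)
  let q : (F →L[ℝ] F) → (F →L[ℝ] F) := fun T =>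
    (1 / 2 : ℝ) • (s (((2 : ℝ) • T - 1) * ((2 : ℝ) • T - 1)) + ((2 : ℝ) • T - 1))
  refine ⟨q, fun η' hη' => ?_⟩
  obtain ⟨η, hη, hηη', hη4⟩ : ∃ η : ℝ, 0 < η ∧ 2 * η ≤ η' ∧ η ≤ 1 / 8 :=
    ⟨min (η' / 2) (1 / 8), by positivity,
      by linarith [min_le_left (η' / 2) (1 / 8)], min_le_right _ _⟩
  set g : (F →L[ℝ] F) → (F →L[ℝ] F) := fun u => s (1 + u) - 1 with hg
  have hg0 : g 0 = 0 := by simp [hg, hs1]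
  have hgsmooth : ContDiffAt ℝ ω g 0 := by
    refine ContDiffAt.sub ?_ contDiffAt_const
    refine ContDiffAt.comp (g := s) (f := fun u => 1 + u) 0 ?_
      (contDiffAt_const.add contDiffAt_id)
    simpa using hsmooth
  obtain ⟨τ, hτ, hsτ⟩ := Metric.eventually_nhds_iff_ball.1 hssq
  obtain ⟨a₀, ha₀, hcomp⟩ := C2Bound.exists_comp (E := E) hgsmooth hg0 hη
  obtain ⟨a, ha, haη, haa, haτ⟩ : ∃ a : ℝ, 0 < a ∧ a ≤ η ∧ 64 * a ≤ a₀ ∧ 64 * a < τ :=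
    ⟨min η (min (a₀ / 64) (τ / 65)), by positivity, min_le_left _ _, by
      linarith [(min_le_right η (min (a₀ / 64) (τ / 65))).trans (min_le_left _ _)], by
      linarith [(min_le_right η (min (a₀ / 64) (τ / 65))).trans (min_le_right _ _)]⟩
  refine ⟨a, ha, fun P hPP hPn U hU α hα => ?_⟩
  set R₀ : F →L[ℝ] F := (2 : ℝ) • P - 1 with hR₀
  have hR₀R₀ : R₀ * R₀ = 1 := by
    have h1 : R₀ * R₀ = (4 : ℝ) • (P * P) - (4 : ℝ) • P + 1 := by
      simp only [hR₀, sub_mul, mul_sub, smul_mul_smul_comm, mul_one, one_mul]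
      module
    rw [h1, hPP]
    abel
  have hR₀n : ‖R₀‖ ≤ 3 := by
    have h1 : ‖(1 : F →L[ℝ] F)‖ ≤ 1 := ContinuousLinearMap.norm_id_le
    have h2 : ‖(2 : ℝ) • P‖ ≤ 2 := by
      rw [norm_smul, Real.norm_two]; linarith
    exact (norm_sub_le _ _).trans (by linarith)
  set β : E → F →L[ℝ] F := fun y => α y + α y with hβ
  have hβb : C2Bound (2 * a) U β := (hα.add hU hα).mono (by linarith)
  have hRβ : ∀ y, (2 : ℝ) • (P + α y) - 1 = R₀ + β y := fun y => by
    simp only [hR₀, hβ]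
    module
  set u : E → F →L[ℝ] F := fun y => R₀ * β y + β y * R₀ + β y * β y with hu
  have hub : C2Bound (64 * a) U u := by
    have hc3 : C2Bound 3 U (fun _ : E => R₀) := (C2Bound.const U R₀).mono hR₀n
    refine (((C2Bound.mul hU (by norm_num) hc3 hβb).add hU
      (C2Bound.mul hU (by positivity) hβb hc3)).add hU
      (C2Bound.mul hU (by positivity) hβb hβb)).mono ?_
    nlinarith
  have hRu : ∀ y, (R₀ + β y) * (R₀ + β y) = 1 + u y := fun y => by
    rw [← hR₀R₀]
    simp only [hu, mul_add, add_mul]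
    abel
  have hγb : C2Bound η U (g ∘ u) := hcomp U hU u (hub.mono haa)
  have hs : ∀ y, s (1 + u y) = 1 + g (u y) := fun y => by simp [hg]
  have hq : ∀ y, q (P + α y) = (1 / 2 : ℝ) • (s (1 + u y) + (R₀ + β y)) := fun y => by
    simp only [q]
    rw [hRβ, hRu]
  have hqP : ∀ y, q (P + α y) - P = α y + (1 / 2 : ℝ) • g (u y) := fun y => by
    rw [hq, hs]
    simp only [hR₀, hβ]
    module
  have hκb : C2Bound (2 * η) U (fun y => q (P + α y) - P) := by
    have h1 : C2Bound η U (fun y => (1 / 2 : ℝ) • g (u y)) :=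
      C2Bound.clm_comp_left hU ((1 / 2 : ℝ) • ContinuousLinearMap.id ℝ (F →L[ℝ] F)) (by
          rw [norm_smul]
          have := ContinuousLinearMap.norm_id_le (𝕜 := ℝ) (E := F →L[ℝ] F)
          norm_num
          linarith) hγb
    exact ((hα.add hU h1).mono (by linarith)).congr fun y _ => hqP y
  refine ⟨hκb.mono hηη', fun y hy v hv => ?_⟩
  have h2 := hκb.norm_le hy
  rw [hq] at hv h2 ⊢
  refine eq_zero_of_apply_eq_zero (P := P) ?_ ?_ (h2.trans (by linarith)) hv
  · rw [hRu]
    apply hsτ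
    rw [Metric.mem_ball, dist_eq_norm, add_sub_cancel_left]
    exact (hub.norm_le hy).trans_lt haτ
  · exact (hγb.norm_le hy).trans (by linarith)

/-- The approximating set, at scale `1`. Let `P p` be the projection to the normal space of the
plane at `p`. Averages over a net `t ⊆ X` with bump function weights give the approximate normal
projection `T y` and the approximate normal displacement `v y`, the weighted mean of `P p (y - p)`.
With the spectral map `q`, the set is `M = {y | q (T y) (v y) = 0}`. This definition involves no
base point, but near `x ∈ X` all planes involved are close to the one at `x`, and the equation is
equivalent to `P x (q (T y) (v y)) = 0`, whose left side is `C²`-close to `P x (y - x)`. -/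
theorem exists_localDesc_level_set (n : ℕ) {c : ℝ} (hc : 0 < c) :
    ∃ ε > 0, ∀ (X : Set (EuclideanSpace ℝ (Fin n)))
      (V : EuclideanSpace ℝ (Fin n) → Submodule ℝ (EuclideanSpace ℝ (Fin n))),
      IsCompact X → PlaneField ε 1 X V →
      ∃ M : Set (EuclideanSpace ℝ (Fin n)), (∀ y ∈ M, ∃ x ∈ X, y ∈ Metric.ball x (3 / 2)) ∧
        ∀ x ∈ X, ∃ ζ, LocalDesc c 1 M x (V x) ζ := by
  obtain ⟨q, hq⟩ := exists_spectral_map (EuclideanSpace ℝ (Fin n)) (EuclideanSpace ℝ (Fin n))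
  obtain ⟨η, hη, hηc⟩ : ∃ η : ℝ, 0 < η ∧ 59 * η ≤ c := ⟨c / 59, by positivity, by linarith⟩
  obtain ⟨a₀, ha₀, hqa⟩ := hq η hη
  obtain ⟨Cb, hCb, hbump⟩ := exists_netBump_bound n
  obtain ⟨Ci, hCi, hinv⟩ := C2Bound.exists_inv (E := EuclideanSpace ℝ (Fin n)) (5 ^ n * (Cb * 1))
  obtain ⟨a, ha, haη, haa, ha1⟩ : ∃ a : ℝ, 0 < a ∧ a ≤ η ∧ a ≤ a₀ ∧ a ≤ 1 :=
    ⟨min η (min a₀ 1), by positivity, min_le_left _ _,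
      (min_le_right _ _).trans (min_le_left _ _), (min_le_right _ _).trans (min_le_right _ _)⟩
  -- `K ε ≤ a` makes the deviations `α` and `w` below bounded by `a`: `Ci` bounds the inverse of the
  -- total weight, `5 ^ n * Cb` a weighted sum, and planes near each other differ by at most `6 ε`.
  set K : ℝ := 4 * Ci * (5 ^ n * (Cb * 6)) with hK
  have hKpos : 0 < K := by positivity
  refine ⟨min 1 (a / K), by positivity, fun X V hX hV => ?_⟩
  set ε := min 1 (a / K) with hε
  have hε0 : 0 < ε := by positivity
  have hε1 : ε ≤ 1 := min_le_left _ _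
  have hKε : K * ε ≤ a := by
    have : ε ≤ a / K := min_le_right _ _
    rwa [le_div_iff₀ hKpos, mul_comm] at this
  obtain ⟨t, htX, htsep, htcov⟩ := hX.exists_finset_separated
  set S : EuclideanSpace ℝ (Fin n) → ℝ := fun y => ∑ p ∈ t, netBump n (y - p) with hS
  set P : EuclideanSpace ℝ (Fin n) → (EuclideanSpace ℝ (Fin n) →L[ℝ] EuclideanSpace ℝ (Fin n)) :=
    fun p => (V p)ᗮ.starProjection with hP
  set T : EuclideanSpace ℝ (Fin n) → (EuclideanSpace ℝ (Fin n) →L[ℝ] EuclideanSpace ℝ (Fin n)) :=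
    fun y => (S y)⁻¹ • ∑ p ∈ t, netBump n (y - p) • P p with hT
  set v : EuclideanSpace ℝ (Fin n) → EuclideanSpace ℝ (Fin n) :=
    fun y => (S y)⁻¹ • ∑ p ∈ t, netBump n (y - p) • P p (y - p) with hv
  refine ⟨{y | (∃ x ∈ X, y ∈ Metric.ball x (3 / 2)) ∧ q (T y) (v y) = 0}, fun y hy => hy.1,
    fun x hx => ?_⟩
  set U : Set (EuclideanSpace ℝ (Fin n)) := Metric.ball x (3 / 2)
  have hU : IsOpen U := Metric.isOpen_ball
  -- Net points that matter in `U` are within `11/2` of `x`.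
  have hnear : ∀ p ∈ t, ∀ y ∈ U, dist y p ≤ 4 → dist x p ≤ 11 / 2 := fun p _ y hy hyp => by
    have h1 := Metric.mem_ball.1 hy
    have h2 := dist_triangle x y p
    rw [dist_comm x y] at h2
    linarith
  have hS1 : ∀ y ∈ U, 1 ≤ S y := fun y hy => by
    obtain ⟨p, hp, hxp⟩ := htcov x hx
    have h1 : netBump n (y - p) = 1 := by
      apply (netBump n).one_of_mem_closedBall
      rw [mem_closedBall_zero_iff, ← dist_eq_norm]
      change dist y p ≤ 7 / 2
      linarith [dist_triangle y x p, Metric.mem_ball.1 hy]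
    rw [← h1]
    exact Finset.single_le_sum (f := fun p => netBump n (y - p))
      (fun q _ => (netBump n).nonneg) hp
  have hSb : C2Bound (5 ^ n * (Cb * 1)) U S := by
    have := c2Bound_sum_netBump htsep hbump hU zero_le_one (fun _ => (1 : ℝ)) (by simp)
    simpa [hS] using this
  have hSi : C2Bound Ci U (fun y => (S y)⁻¹) := hinv U hU S hSb hS1
  -- The deviations from the plane at `x`: `T = P x + α` and `v = T (y - x) + w`.
  set α : EuclideanSpace ℝ (Fin n) → (EuclideanSpace ℝ (Fin n) →L[ℝ] EuclideanSpace ℝ (Fin n)) :=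
    fun y => (S y)⁻¹ • ∑ p ∈ t, netBump n (y - p) • (P p - P x) with hα
  set w : EuclideanSpace ℝ (Fin n) → EuclideanSpace ℝ (Fin n) :=
    fun y => (S y)⁻¹ • ∑ p ∈ t, netBump n (y - p) • P p (x - p) with hw
  have hαb : C2Bound a U α := by
    have h1 := c2Bound_sum_netBump htsep hbump hU (a := 6 * ε) (by positivity)
      (fun p => P p - P x)
      (fun p hp y hy hyp => hV.norm_starProjection_sub_le hε1 hx (htX hp) (hnear p hp y hy hyp))
    refine (C2Bound.smul hU hCi.le hSi h1).mono (le_trans (le_of_eq ?_) hKε)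
    rw [hK]; ring
  have hwb : C2Bound a U w := by
    have h1 := c2Bound_sum_netBump htsep hbump hU (a := 6 * ε) (by positivity)
      (fun p => P p (x - p)) (fun p hp y hy hyp => by
        have := hV.norm_proj_le p (htX hp) x hx (by linarith [hnear p hp y hy hyp])
        linarith)
    refine (C2Bound.smul hU hCi.le hSi h1).mono (le_trans (le_of_eq ?_) hKε)
    rw [hK]; ring
  have hTα : ∀ y ∈ U, T y = P x + α y := fun y hy => by
    have h0 : S y ≠ 0 := by linarith [hS1 y hy]
    simp only [hT, hα, smul_sub, Finset.sum_sub_distrib, ← Finset.sum_smul]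
    change _ = P x + ((S y)⁻¹ • _ - (S y)⁻¹ • (S y • P x))
    rw [smul_smul, inv_mul_cancel₀ h0, one_smul]
    abel
  have hvw : ∀ y ∈ U, v y = T y (y - x) + w y := fun y hy => by
    simp only [hT, hw, hv, smul_apply, sum_apply, ← smul_add, ← Finset.sum_add_distrib,
      ← map_add, sub_add_sub_cancel]
  have hPP : P x * P x = P x := (V x)ᗮ.isIdempotentElem_starProjection
  have hPn : ‖P x‖ ≤ 1 := (V x)ᗮ.starProjection_norm_le
  obtain ⟨hκb, hqinj⟩ := hqa (P x) hPP hPn U hU α (hαb.mono haa)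
  set κ : EuclideanSpace ℝ (Fin n) → (EuclideanSpace ℝ (Fin n) →L[ℝ] EuclideanSpace ℝ (Fin n)) :=
    fun y => q (P x + α y) - P x with hκ
  set z : EuclideanSpace ℝ (Fin n) → EuclideanSpace ℝ (Fin n) :=
    fun y => (α y (y - x) + w y) + κ y ((P x + α y) (y - x) + w y) with hz
  have hid : C2Bound (3 / 2) U (fun y => y - x) :=
    C2Bound.sub_const hU x (by norm_num) subset_rfl
  have hzb : C2Bound c U (fun y => P x (z y)) := by
    refine C2Bound.clm_comp_left hU (P x) hPn ?_
    have h1 := (C2Bound.clm_apply hU ha.le hαb hid).add hU hwb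
    have h2 : C2Bound 2 U (fun y => P x + α y) :=
      (((C2Bound.const U (P x)).mono hPn).add hU hαb).mono (by linarith)
    have h3 := (C2Bound.clm_apply hU (by norm_num) h2 hid).add hU hwb
    have h4 := C2Bound.clm_apply hU hη.le hκb h3
    refine (h1.add hU h4).mono ?_
    nlinarith
  have hFz : ∀ y ∈ U, P x (q (T y) (v y)) = P x (y + P x (z y) - x) := fun y hy => by
    have hPPa : ∀ b, P x (P x b) = P x b := fun b => congrArg (fun L => L b) hPP
    have h1 : q (P x + α y) = P x + κ y := (add_sub_cancel _ _).symm
    rw [hvw y hy, hTα y hy, h1, hz]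
    simp only [add_apply, map_add, map_sub, hPPa]
    abel
  refine ⟨fun y => P x (z y), ?_⟩
  have hball : Metric.ball x (3 / 2 * 1) = U := by rw [mul_one]
  refine ⟨hball ▸ hzb.contDiffOn, fun y hy => ?_, fun y hy => ?_, fun y hy => ?_, fun y hy => ?_⟩
  · rw [hball] at hy
    have hmem : y + P x (z y) - x ∈ V x ↔ P x (q (T y) (v y)) = 0 := by
      rw [hFz y hy, hP, Submodule.starProjection_apply_eq_zero_iff,
        Submodule.orthogonal_orthogonal]
    rw [hmem]
    constructor
    · intro h
      rw [h.2, map_zero]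
    · intro h
      refine ⟨⟨x, hx, hy⟩, ?_⟩
      rw [hTα y hy] at h ⊢
      exact hqinj y hy _ h
  · rw [hball] at hy; simpa using hzb.norm_le hy
  · rw [hball] at hy; exact hzb.norm_fderiv_le hU hy
  · rw [hball] at hy; simpa using hzb.norm_fderiv_fderiv_le hU hy

end PlaneFields

/-! ### Rescaling and conclusion -/

section Rescaling

variable {n : ℕ}

theorem PlaneField.mono {ε ε' r : ℝ} (hr : 0 ≤ r) {X : Set (EuclideanSpace ℝ (Fin n))}
    {V : EuclideanSpace ℝ (Fin n) → Submodule ℝ (EuclideanSpace ℝ (Fin n))}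
    (h : PlaneField ε r X V) (hε : ε ≤ ε') : PlaneField ε' r X V := by
  have hle : ε * r ≤ ε' * r := mul_le_mul_of_nonneg_right hε hr
  refine ⟨fun x hx p hp hpr => ?_, fun x hx q hq hqx => (h.norm_proj_le x hx q hq hqx).trans hle⟩
  obtain ⟨q, hq, hqp⟩ := h.exists_near x hx p hp hpr
  exact ⟨q, hq, hqp.trans hle⟩

theorem PlaneField.rescale {ε r : ℝ} (hr : 0 < r) {X : Set (EuclideanSpace ℝ (Fin n))}
    {V : EuclideanSpace ℝ (Fin n) → Submodule ℝ (EuclideanSpace ℝ (Fin n))}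
    (h : PlaneField ε r X V) : PlaneField ε 1 {y | r • y ∈ X} (fun y => V (r • y)) := by
  refine ⟨fun x hx p hp hp2 => ?_, fun x hx q hq hqx => ?_⟩
  · obtain ⟨q, hq, hqp⟩ := h.exists_near _ hx (r • p) ((V _).smul_mem r hp) (by
      rw [norm_smul, Real.norm_of_nonneg hr.le]; nlinarith)
    refine ⟨r⁻¹ • q, ?_, ?_⟩
    · change r • r⁻¹ • q ∈ X
      rwa [smul_inv_smul₀ hr.ne']
    · have h1 : dist (r • r⁻¹ • q) (r • (x + p)) = r * dist (r⁻¹ • q) (x + p) := by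
        rw [dist_smul₀, Real.norm_of_nonneg hr.le]
      rw [smul_inv_smul₀ hr.ne', smul_add] at h1
      rw [h1, mul_comm] at hqp
      rw [mul_one]
      exact le_of_mul_le_mul_right hqp hr
  · have h1 := h.norm_proj_le _ hx _ hq (by
      rw [dist_smul₀, Real.norm_of_nonneg hr.le]; nlinarith)
    rw [← smul_sub, map_smul, norm_smul, Real.norm_of_nonneg hr.le, mul_comm] at h1
    rw [mul_one]
    exact le_of_mul_le_mul_right h1 hr

theorem LocalDesc.rescale {c r : ℝ} (hr : 0 < r) {M : Set (EuclideanSpace ℝ (Fin n))}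
    {x : EuclideanSpace ℝ (Fin n)} {V : Submodule ℝ (EuclideanSpace ℝ (Fin n))}
    {ζ : EuclideanSpace ℝ (Fin n) → EuclideanSpace ℝ (Fin n)}
    (h : LocalDesc c 1 M (r⁻¹ • x) V ζ) :
    LocalDesc c r {y | r⁻¹ • y ∈ M} x V (fun y => r • ζ (r⁻¹ • y)) := by
  have hmem : ∀ y ∈ Metric.ball x (3 / 2 * r), r⁻¹ • y ∈ Metric.ball (r⁻¹ • x) (3 / 2 * 1) := by
    intro y hy
    rw [Metric.mem_ball] at hy ⊢
    rw [dist_smul₀, norm_inv, Real.norm_of_nonneg hr.le, inv_mul_lt_iff₀ hr]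
    linarith
  have hfd : fderiv ℝ (fun y => r • ζ (r⁻¹ • y)) = fun y => fderiv ℝ ζ (r⁻¹ • y) := by
    ext1 y
    have h1 : (fun y => r • ζ (r⁻¹ • y)) = r • fun y => ζ (r⁻¹ • y) := rfl
    rw [h1, fderiv_const_smul_field, Pi.smul_apply, fderiv_comp_smul, smul_smul, mul_inv_cancel₀ hr.ne', one_smul]
  refine ⟨?_, fun y hy => ?_, fun y hy => ?_, fun y hy => ?_, fun y hy => ?_⟩
  · exact (h.contDiffOn.comp (contDiff_const_smul r⁻¹).contDiffOn hmem).const_smul r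
  · rw [Set.mem_ofPred_eq, h.mem_iff _ (hmem y hy)]
    have : y + r • ζ (r⁻¹ • y) - x = r • (r⁻¹ • y + ζ (r⁻¹ • y) - r⁻¹ • x) := by
      rw [smul_sub, smul_add, smul_inv_smul₀ hr.ne', smul_inv_smul₀ hr.ne']
    rw [this, V.smul_mem_iff hr.ne']
  · have := h.norm_le _ (hmem y hy)
    rw [norm_smul, Real.norm_of_nonneg hr.le]
    nlinarith
  · rw [hfd]
    exact h.norm_fderiv_le _ (hmem y hy)
  · rw [hfd, fderiv_comp_smul, div_eq_inv_mul]
    have := h.norm_fderiv_fderiv_le _ (hmem y hy)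
    rw [div_one] at this
    refine (ContinuousLinearMap.opNorm_smul_le _ _).trans ?_
    rw [norm_inv, Real.norm_of_nonneg hr.le]
    gcongr

/-- The planes of a Reifenberg flat set at scale `9 r` form a plane field at scale `r`. -/
theorem IsReifenbergFlat.exists_planeField {k : ℕ} {ε R r : ℝ} (hε : 0 < ε)
    {X : Set (EuclideanSpace ℝ (Fin n))} (hX : IsReifenbergFlat k ε R X) (hr : 0 < r)
    (hrR : r < R / 10) :
    ∃ V : EuclideanSpace ℝ (Fin n) → Submodule ℝ (EuclideanSpace ℝ (Fin n)),
      PlaneField (10 * ε) r X V ∧ ∀ x ∈ X, Module.finrank ℝ (V x) = k := by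
  choose! P hxP hPk hPd using fun x hx => hX.exists_plane x hx (9 * r) (by positivity) (by linarith)
  have hlt : ENNReal.ofReal (ε * (9 * r)) < ENNReal.ofReal (10 * ε * r) :=
    (ENNReal.ofReal_lt_ofReal_iff (by positivity)).2 (by nlinarith [mul_pos hε hr])
  refine ⟨fun x => (P x).direction, ⟨fun x hx p hp hpr => ?_, fun x hx q hq hqx => ?_⟩, hPk⟩
  · have hmem : x + p ∈ Metric.ball x (9 * r) ∩ (P x : Set (EuclideanSpace ℝ (Fin n))) := by
      refine ⟨?_, ?_⟩
      · rw [mem_ball_iff_norm, add_sub_cancel_left]; linarith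
      · have := AffineSubspace.vadd_mem_of_mem_direction hp (hxP x hx)
        rwa [vadd_eq_add, add_comm] at this
    obtain ⟨q, hq, hqd⟩ := Metric.exists_edist_lt_of_hausdorffEDist_lt hmem
      ((hPd x hx).trans_lt hlt)
    refine ⟨q, hq.2, ?_⟩
    rw [edist_dist, ENNReal.ofReal_lt_ofReal_iff (by positivity), dist_comm] at hqd
    exact hqd.le
  · have hd := hPd x hx
    rw [Metric.hausdorffEDist_comm] at hd
    obtain ⟨z, hz, hzd⟩ := Metric.exists_edist_lt_of_hausdorffEDist_lt
      (Set.mem_inter (Metric.mem_ball.2 hqx) hq) (hd.trans_lt hlt)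
    rw [edist_dist, ENNReal.ofReal_lt_ofReal_iff (by positivity), dist_eq_norm] at hzd
    have hzV : z - x ∈ (P x).direction := AffineSubspace.vsub_mem_direction hz.2 (hxP x hx)
    have h0 : ((P x).direction)ᗮ.starProjection (z - x) = 0 := by
      rw [Submodule.starProjection_apply_eq_zero_iff, Submodule.orthogonal_orthogonal]
      exact hzV
    have h1 : q - x = (q - z) + (z - x) := by abel
    rw [h1, map_add, h0, add_zero]
    exact (Submodule.norm_starProjection_apply_le _ _).trans hzd.le

end Rescaling

section Conclusion

variable {n : ℕ} {c ε r : ℝ} {X M : Set (EuclideanSpace ℝ (Fin n))}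
  {V : EuclideanSpace ℝ (Fin n) → Submodule ℝ (EuclideanSpace ℝ (Fin n))}

theorem exists_mem_dist_le (hr : 0 < r) (hc : c ≤ 1 / 4) (hV : PlaneField ε r X V)
    (hMX : ∀ y ∈ M, ∃ x ∈ X, y ∈ Metric.ball x (3 / 2 * r))
    (hM : ∀ x ∈ X, ∃ ζ, LocalDesc c r M x (V x) ζ) {y : EuclideanSpace ℝ (Fin n)} (hy : y ∈ M) :
    ∃ q ∈ X, dist y q ≤ (c + ε) * r := by
  obtain ⟨x, hx, hyx⟩ := hMX y hy
  obtain ⟨ζ, hζ⟩ := hM x hx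
  have h1 := hζ.norm_le y hyx
  have h2 : ‖y + ζ y - x‖ ≤ 2 * r := by
    have h3 : y + ζ y - x = (y - x) + ζ y := by abel
    have h4 := mem_ball_iff_norm.1 hyx
    rw [h3]
    refine (norm_add_le _ _).trans ?_
    nlinarith
  obtain ⟨q, hq, hqd⟩ := hV.exists_near x hx _ ((hζ.mem_iff y hyx).1 hy) h2
  refine ⟨q, hq, ?_⟩
  rw [add_sub_cancel] at hqd
  have h5 : dist y (y + ζ y) = ‖ζ y‖ := by simp [dist_eq_norm]
  have := dist_triangle_right y q (y + ζ y)
  linarith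

/-- Limits of points of `M` lie well inside the balls in which `M` is known to be relatively
closed. -/
theorem isCompact_of_localDesc (hr : 0 < r) (hc : c ≤ 1 / 4) (hε : ε ≤ 1 / 4) (hX : IsCompact X)
    (hV : PlaneField ε r X V) (hMX : ∀ y ∈ M, ∃ x ∈ X, y ∈ Metric.ball x (3 / 2 * r))
    (hM : ∀ x ∈ X, ∃ ζ, LocalDesc c r M x (V x) ζ) : IsCompact M := by
  refine Metric.isCompact_of_isClosed_isBounded ?_ ?_
  · refine isClosed_of_closure_subset fun y hy => ?_
    obtain ⟨y', hy', hd⟩ := Metric.mem_closure_iff.1 hy (r / 4) (by positivity)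
    obtain ⟨x, hx, hxd⟩ := exists_mem_dist_le hr hc hV hMX hM hy'
    have hyx : y ∈ Metric.ball x (3 / 2 * r) := by
      rw [Metric.mem_ball]
      have := dist_triangle y y' x
      nlinarith
    obtain ⟨ζ, hζ⟩ := hM x hx
    rw [hζ.mem_iff y hyx]
    by_contra hne
    have hcont : ContinuousAt (fun y => y + ζ y - x) y :=
      (continuousAt_id.add (hζ.contDiffAt hyx).continuousAt).sub continuousAt_const
    have hev : ∀ᶠ w in nhds y, w + ζ w - x ∉ V x :=
      hcont.eventually ((V x).closed_of_finiteDimensional.isOpen_compl.mem_nhds hne)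
    have hball : ∀ᶠ w in nhds y, w ∈ Metric.ball x (3 / 2 * r) :=
      Metric.isOpen_ball.mem_nhds hyx
    obtain ⟨w, hwM, hw, hwx⟩ := ((mem_closure_iff_frequently.1 hy).and_eventually
      (hev.and hball)).exists
    exact hw ((hζ.mem_iff w hwx).1 hwM)
  · refine (hX.isBounded.thickening (δ := 3 / 2 * r)).subset fun y hy => ?_
    obtain ⟨x, hx, hyx⟩ := hMX y hy
    exact Metric.mem_thickening_iff.2 ⟨x, hx, hyx⟩

end Conclusion

theorem theorem2p1 (n k : ℕ) (δ : ℝ) (hδ : 0 < δ) :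
    ∃ ε : ℝ, 0 < ε ∧
      ∀ (R : ℝ) (X : Set (EuclideanSpace ℝ (Fin n))), 0 < R → IsReifenbergFlat k ε R X →
        ∀ r : ℝ, 0 < r → r < R / 10 →
          ∃ Xr : Set (EuclideanSpace ℝ (Fin n)),
            IsCompact Xr ∧ IsSmoothSubmanifold k Xr ∧
            Metric.hausdorffEDist X Xr ≤ ENNReal.ofReal (δ * r) ∧
            SecondFundFormLe k Xr (δ / r) ∧
            ∀ x ∈ X, ∃ G B : Set (EuclideanSpace ℝ (Fin n)),
              Xr ∩ Metric.ball x r = G ∪ B ∧ IsConnected G ∧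
              B ⊆ Metric.ball x r \ Metric.ball x ((1 - δ) * r) := by
  -- The second fundamental form is bounded by `2 k c / r`, the frontier layer has width `2 c r`.
  obtain ⟨c, hc, hc4, hcδ⟩ : ∃ c : ℝ, 0 < c ∧ c ≤ 1 / 4 ∧ 2 * (k + 1) * c ≤ δ := by
    refine ⟨min (1 / 4) (δ / (2 * (k + 1))), by positivity, min_le_left _ _, ?_⟩
    have := min_le_right (1 / 4) (δ / (2 * ((k : ℝ) + 1)))
    rwa [le_div_iff₀ (by positivity), mul_comm] at this
  have hk0 : (0 : ℝ) ≤ k := k.cast_nonneg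
  have h2c : 2 * c ≤ δ := by nlinarith
  obtain ⟨ε₀, hε₀, hlevel⟩ := exists_localDesc_level_set n hc
  obtain ⟨ε, hε, hεε₀, hε4, hεδ⟩ : ∃ ε : ℝ, 0 < ε ∧ ε ≤ ε₀ ∧ ε ≤ 1 / 4 ∧ ε ≤ δ / 2 :=
    ⟨min ε₀ (min (1 / 4) (δ / 2)), by positivity, min_le_left _ _,
      (min_le_right _ _).trans (min_le_left _ _), (min_le_right _ _).trans (min_le_right _ _)⟩
  refine ⟨ε / 10, by positivity, fun R X _ hX r hr hrR => ?_⟩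
  obtain ⟨V, hV', hVk⟩ := hX.exists_planeField (by positivity) hr hrR
  have hV : PlaneField ε r X V := hV'.mono hr.le (by linarith)
  have hX' : IsCompact {y | r • y ∈ X} :=
    (Homeomorph.smulOfNeZero r hr.ne').isCompact_preimage.2 hX.isCompact
  obtain ⟨M', hMX', hM'⟩ := hlevel _ _ hX' ((hV.rescale hr).mono zero_le_one hεε₀)
  set M : Set (EuclideanSpace ℝ (Fin n)) := {y | r⁻¹ • y ∈ M'}
  have hM : ∀ x ∈ X, ∃ ζ, LocalDesc c r M x (V x) ζ := fun x hx => by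
    obtain ⟨ζ, hζ⟩ := hM' (r⁻¹ • x) (by
      change r • r⁻¹ • x ∈ X
      rwa [smul_inv_smul₀ hr.ne'])
    rw [smul_inv_smul₀ hr.ne'] at hζ
    exact ⟨_, hζ.rescale hr⟩
  have hMX : ∀ y ∈ M, ∃ x ∈ X, y ∈ Metric.ball x (3 / 2 * r) := fun y hy => by
    obtain ⟨x, hx, hyx⟩ := hMX' _ hy
    refine ⟨r • x, hx, ?_⟩
    have h1 : dist (r • r⁻¹ • y) (r • x) = r * dist (r⁻¹ • y) x := by
      rw [dist_smul₀, Real.norm_of_nonneg hr.le]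
    rw [smul_inv_smul₀ hr.ne'] at h1
    rw [Metric.mem_ball] at hyx ⊢
    rw [h1]
    nlinarith
  refine ⟨M, isCompact_of_localDesc hr hc4 hε4 hX.isCompact hV hMX hM, fun y hy => ?_, ?_,
    fun φ u hu => ?_, fun x hx => ?_⟩
  · obtain ⟨x, hx, hyx⟩ := hMX y hy
    obtain ⟨ζ, hζ⟩ := hM x hx
    obtain ⟨φ, hφ⟩ := hζ.exists_localParam hr hc4 (hVk x hx)
    exact ⟨φ, hφ ▸ hyx⟩
  · refine Metric.hausdorffEDist_le_of_mem_edist (fun x hx => ?_) (fun y hy => ?_)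
    · obtain ⟨ζ, hζ⟩ := hM x hx
      obtain ⟨y, hy, hd⟩ := hζ.exists_mem_near hr hc4
      refine ⟨y, hy, ?_⟩
      rw [edist_dist]
      exact ENNReal.ofReal_le_ofReal (hd.trans (by gcongr; linarith))
    · obtain ⟨q, hq, hd⟩ := exists_mem_dist_le hr hc4 hV hMX hM hy
      refine ⟨q, hq, ?_⟩
      rw [edist_dist]
      exact ENNReal.ofReal_le_ofReal (hd.trans (by gcongr; linarith))
  · have hy : φ.toFun u ∈ M := (φ.image_source ▸ Set.mem_image_of_mem _ hu :
      φ.toFun u ∈ M ∩ φ.nhd).1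
    obtain ⟨x, hx, hyx⟩ := hMX _ hy
    obtain ⟨ζ, hζ⟩ := hM x hx
    refine (φ.normSecondForm_le hu (K := 2 * (c / r)) (by positivity)
      (hζ.norm_starProjection_le hc4 (hVk x hx) φ hu hyx)).trans ?_
    rw [← mul_div_assoc, ← mul_div_assoc]
    gcongr
    nlinarith
  · obtain ⟨ζ, hζ⟩ := hM x hx
    obtain ⟨G, B, hGB, hG, hB⟩ := hζ.exists_connected hr hc4
    refine ⟨G, B, hGB, hG, hB.trans (Set.sdiff_subset_sdiff_right (Metric.ball_subset_ball ?_))⟩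
    gcongr
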